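/- Let $k$ be an algebraically closed field of characteristic zero and let $X$ be a curve over $k$, i.e. an integral separated scheme of finite type over $k$ of dimension one. For a $k$-scheme $Z$, let $Z_\infty$ be its space of arcs: the $k$-scheme obtained by gluing, over the affine open subsets $U=\operatorname{Spec}A$ of $Z$, the schemes $U_\infty=\operatorname{Spec}\mathrm{HS}(A)$, where $\mathrm{HS}(A)$ is the Hasse–Schmidt algebra, i.e. the $k$-algebra representing the functor $B\mapsto \operatorname{Hom}_{k\text{-alg}}(A,B[[t]])$ on $k$-algebras. In particular, for every field extension $K/k$ the $K$-points of $Z_\infty$ are the formal arcs $\alpha\colon\operatorname{Spec}K[[t]]\to Z$ over $k$. Let $\pi_Z\colon Z_\infty\to Z$, $\alpha\mapsto\alpha(0)$, be the canonical projection, and for a morphism $f\colon Y\to X$ over $k$ let $f_\infty\colon Y_\infty\to X_\infty$, $\alpha\mapsto f\circ\alpha$, be the induced morphism. Let $P\in X$ be a singular point (that is, $\mathcal O_{X,P}$ is not a regular local ring) and let $f\colon Y\to X$ be the normalization of $X$. Then $f^{-1}(P)=\{Q_1,\dots,Q_r\}$ is a finite set, say with exactly $r$ elements, and: 1. the fiber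 $\pi_X^{-1}(P)\subset X_\infty$, with its Zariski topology, has exactly $r$ irreducible components; 2. for every $i=1,\dots,r$, the set $f_\infty\big(\pi_Y^{-1}(Q_i)\big)$ is closed in $X_\infty$ and is one of the irreducible components of $\pi_X^{-1}(P)$. -/

import Mathlib

open CategoryTheory Limits AlgebraicGeometry

universe u

namespace HasseSchmidt

variable {k A A' A'' B : Type u} [CommRing k] [CommRing A] [CommRing A'] [CommRing A'']
  [CommRing B]

/-- For a `k`-algebra `A` (given by its structure map `φ : k → A`): the relations between the symbols
`D_n(a)`, `n ≥ 0`, `a ∈ A`, which express that `a ↦ ∑ D_n(a) t ^ n` is a homomorphism of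
`k`-algebras, i.e. that the `D_n` are additive, satisfy the Leibniz rule
`D_n(ab) = ∑_{i+j=n} D_i(a) D_j(b)`, and `D_0(c) = c`, `D_n(c) = 0` for `n > 0` and `c ∈ k`. -/
inductive JetRelation (φ : k →+* A) : MvPolynomial (ℕ × A) k → Prop
  | add (n : ℕ) (a b : A) : JetRelation φ (.X (n, a + b) - (.X (n, a) + .X (n, b)))
  | mul (n : ℕ) (a b : A) : JetRelation φ (.X (n, a * b) -
      ∑ ij ∈ Finset.HasAntidiagonal.antidiagonal n, .X (ij.1, a) * .X (ij.2, b))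
  | const_zero (c : k) : JetRelation φ (.X (0, φ c) - .C c)
  | const_pos (n : ℕ) (c : k) : JetRelation φ (.X (n + 1, φ c))

/-- The Hasse-Schmidt algebra of the `k`-algebra `φ : k → A`: the coordinate ring of the arc space of
`Spec A` over `k`. It is the `k`-algebra generated by the symbols `D_n(a)` subject to the relations
`JetRelation`; for `A = k[x₁, …, x_N] / (f₁, …, f_m)` it is the quotient of the polynomial ring in the
`x_j^{(n)} = D_n(x_j)` by all the `D_n(f_i)`. Homomorphisms of `k`-algebras `HS φ → B` are the same as
`B`-valued arcs, i.e. homomorphisms of `k`-algebras `A → B⟦t⟧` (see `lift`, `lift_D`, `hom_ext`). -/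
def HS (φ : k →+* A) : Type u := MvPolynomial (ℕ × A) k ⧸ Ideal.span {p | JetRelation φ p}

noncomputable instance (φ : k →+* A) : CommRing (HS φ) :=
  inferInstanceAs (CommRing (MvPolynomial (ℕ × A) k ⧸ Ideal.span {p | JetRelation φ p}))

/-- The presentation of the Hasse-Schmidt algebra. -/
noncomputable def proj (φ : k →+* A) : MvPolynomial (ℕ × A) k →+* HS φ :=
  Ideal.Quotient.mk _

/-- The element `D_n(a)` of the Hasse-Schmidt algebra. -/
noncomputable def D (φ : k →+* A) (n : ℕ) (a : A) : HS φ := proj φ (.X (n, a))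

variable (φ : k →+* A) (φ' : k →+* A') (φ'' : k →+* A'')

lemma proj_eq_zero {p} (h : JetRelation φ p) : proj φ p = 0 :=
  Ideal.Quotient.eq_zero_iff_mem.mpr (Ideal.subset_span h)

lemma D_add (n : ℕ) (a b : A) : D φ n (a + b) = D φ n a + D φ n b := by
  have := proj_eq_zero φ (.add n a b)
  rwa [map_sub, map_add, sub_eq_zero] at this

lemma D_mul (n : ℕ) (a b : A) :
    D φ n (a * b) = ∑ ij ∈ Finset.HasAntidiagonal.antidiagonal n, D φ ij.1 a * D φ ij.2 b := by
  have := proj_eq_zero φ (.mul n a b)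
  rw [map_sub, sub_eq_zero, map_sum] at this
  simp only [map_mul] at this
  exact this

lemma D_zero_const (c : k) : D φ 0 (φ c) = proj φ (.C c) := by
  have := proj_eq_zero φ (.const_zero c)
  rwa [map_sub, sub_eq_zero] at this

lemma D_succ_const (n : ℕ) (c : k) : D φ (n + 1) (φ c) = 0 :=
  proj_eq_zero φ (.const_pos n c)

/-- The universal arc `A → (HS φ)⟦t⟧`, `a ↦ ∑ D_n(a) t ^ n`. -/
noncomputable def univ : A →+* PowerSeries (HS φ) where
  toFun a := PowerSeries.mk fun n ↦ D φ n a
  map_add' a b := by ext n; simp [D_add]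
  map_mul' a b := by ext n; simp [D_mul, PowerSeries.coeff_mul]
  map_one' := by
    ext n
    rw [PowerSeries.coeff_mk, ← map_one φ, PowerSeries.coeff_one]
    cases n with
    | zero => rw [D_zero_const]; simp
    | succ n => rw [D_succ_const]; simp
  map_zero' := by
    ext n
    rw [PowerSeries.coeff_mk, map_zero, ← map_zero φ]
    cases n with
    | zero => rw [D_zero_const]; simp
    | succ n => rw [D_succ_const]

@[simp] lemma coeff_univ (n : ℕ) (a : A) : PowerSeries.coeff n (univ φ a) = D φ n a :=
  PowerSeries.coeff_mk n fun n ↦ D φ n a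

lemma univ_comp : (univ φ).comp φ = PowerSeries.C.comp ((proj φ).comp MvPolynomial.C) := by
  ext c n
  cases n with
  | zero => simp [D_zero_const]
  | succ n => simp [D_succ_const]

variable {φ} in
lemma hom_ext {f g : HS φ →+* B} (h : ∀ n a, f (D φ n a) = g (D φ n a)) : f = g := by
  apply Ideal.Quotient.ringHom_ext
  apply MvPolynomial.ringHom_ext
  · intro c
    have := h 0 (φ c)
    rwa [D_zero_const] at this
  · rintro ⟨n, a⟩
    exact h n a

/-- The homomorphism `HS φ → B` that classifies a `B`-valued arc `g : A → B⟦t⟧` over `k`. -/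
noncomputable def lift (ψ : k →+* B) (g : A →+* PowerSeries B)
    (h : g.comp φ = PowerSeries.C.comp ψ) : HS φ →+* B :=
  Ideal.Quotient.lift _ (MvPolynomial.eval₂Hom ψ fun p ↦ PowerSeries.coeff p.1 (g p.2)) (by
    suffices Ideal.span {p | JetRelation φ p} ≤ RingHom.ker
      (MvPolynomial.eval₂Hom ψ fun p : ℕ × A ↦ PowerSeries.coeff p.1 (g p.2)) from
        fun a ha ↦ this ha
    rw [Ideal.span_le]
    have hc (c : k) : g (φ c) = PowerSeries.C (ψ c) := congr($h c)
    rintro _ (⟨n, a, b⟩ | ⟨n, a, b⟩ | ⟨c⟩ | ⟨n, c⟩)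
    · simp [RingHom.mem_ker]
    · simp [RingHom.mem_ker, PowerSeries.coeff_mul]
    · simp [RingHom.mem_ker, hc]
    · simp [RingHom.mem_ker, hc])

@[simp] lemma lift_D (ψ : k →+* B) (g : A →+* PowerSeries B)
    (h : g.comp φ = PowerSeries.C.comp ψ) (n : ℕ) (a : A) :
    lift φ ψ g h (D φ n a) = PowerSeries.coeff n (g a) :=
  (Ideal.Quotient.lift_mk ..).trans (MvPolynomial.eval₂Hom_X' ..)

variable {φ φ' φ''} in
/-- Functoriality: the map `D_n(a) ↦ D_n(g a)` induced by a homomorphism of `k`-algebras `g`. -/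
noncomputable def map (g : A →+* A') (h : g.comp φ = φ') : HS φ →+* HS φ' :=
  lift φ ((proj φ').comp MvPolynomial.C) ((univ φ').comp g)
    (by rw [RingHom.comp_assoc, h, univ_comp])

variable {φ φ' φ''} in
@[simp] lemma map_D (g : A →+* A') (h : g.comp φ = φ') (n : ℕ) (a : A) :
    map g h (D φ n a) = D φ' n (g a) := by
  simp [map]

lemma map_id (h : (RingHom.id A).comp φ = φ) : map (RingHom.id A) h = RingHom.id (HS φ) :=
  hom_ext fun n a ↦ by simp

variable {φ φ' φ''} in
lemma map_comp_map (g : A →+* A') (h : g.comp φ = φ') (g' : A' →+* A'') (h' : g'.comp φ' = φ'')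
    (h'' : (g'.comp g).comp φ = φ'') : (map g' h').comp (map g h) = map (g'.comp g) h'' :=
  hom_ext fun n a ↦ by simp

/-- The structure of an `A`-algebra on `HS φ`, `a ↦ D_0(a)`; on arcs it is `α(t) ↦ α(0)`. -/
noncomputable def const : A →+* HS φ := PowerSeries.constantCoeff.comp (univ φ)

@[simp] lemma const_apply (a : A) : const φ a = D φ 0 a := by
  simp [const, ← PowerSeries.coeff_zero_eq_constantCoeff_apply]

variable {φ φ'} in
lemma map_comp_const (g : A →+* A') (h : g.comp φ = φ') :
    (map g h).comp (const φ) = (const φ').comp g := by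
  ext a; simp

variable {φ φ'} in
/-- The Hasse-Schmidt algebra of `A[1/r]` is the localization of that of `A` at `D_0(r)`. -/
lemma isLocalizationAway (g : A →+* A') (h : g.comp φ = φ') (r : A)
    (hg : letI := g.toAlgebra; IsLocalization.Away r A') :
    letI := (map g h).toAlgebra
    IsLocalization.Away (const φ r) (HS φ') := by
  let := g.toAlgebra
  let := (map g h).toAlgebra
  let L := Localization.Away (const φ r)
  -- the map `L → HS φ'`
  have hu : IsUnit (algebraMap (HS φ) (HS φ') (const φ r)) := by
    have : algebraMap (HS φ) (HS φ') (const φ r) = const φ' (g r) := by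
      simp [RingHom.algebraMap_toAlgebra]
    rw [this]
    exact (IsLocalization.Away.algebraMap_isUnit (S := A') r).map (const φ')
  let p : L →+* HS φ' := IsLocalization.Away.lift (S := L) (const φ r) hu
  have hp (x) : p (algebraMap (HS φ) L x) = map g h x := IsLocalization.Away.lift_eq _ hu x
  let a₀ : A →+* PowerSeries L := (PowerSeries.map (algebraMap (HS φ) L)).comp (univ φ)
  have hr : IsUnit (a₀ r) := by
    rw [PowerSeries.isUnit_iff_constantCoeff]
    have : PowerSeries.constantCoeff (a₀ r) = algebraMap (HS φ) L (const φ r) := by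
      simp [a₀, ← PowerSeries.coeff_zero_eq_constantCoeff_apply]
    rw [this]
    exact IsLocalization.Away.algebraMap_isUnit _
  let a₁ : A' →+* PowerSeries L := IsLocalization.Away.lift (S := A') r hr
  have ha (x) : a₁ (g x) = a₀ x := IsLocalization.Away.lift_eq _ hr x
  let q : HS φ' →+* L := lift φ' ((algebraMap (HS φ) L).comp ((proj φ).comp MvPolynomial.C)) a₁ (by
    ext c : 1
    have := congr($(univ_comp φ) c)
    simp only [RingHom.comp_apply] at this ⊢
    rw [← h, RingHom.comp_apply, ha]
    simp only [a₀, RingHom.comp_apply, this, PowerSeries.map_C])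
  have hq (x) : q (map g h x) = algebraMap (HS φ) L x := by
    suffices q.comp (map g h) = algebraMap (HS φ) L from congr($this x)
    refine hom_ext fun n a ↦ ?_
    simp [q, ha, a₀]
  have hpq : p.comp q = RingHom.id _ := by
    refine hom_ext fun n a ↦ ?_
    have key : (PowerSeries.map p).comp a₁ = univ φ' := by
      refine IsLocalization.ringHom_ext (R := A) (Submonoid.powers r) ?_
      ext x n
      change PowerSeries.coeff n (PowerSeries.map p (a₁ (g x))) = PowerSeries.coeff n (univ φ' (g x))
      rw [ha]
      simp [a₀, hp]
    have := congr(PowerSeries.coeff n ($key a))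
    simpa [q] using this
  have hqp : q.comp p = RingHom.id _ := by
    refine IsLocalization.ringHom_ext (R := HS φ) (Submonoid.powers (const φ r)) ?_
    ext x : 1
    simp [hp, hq]
  let e : L ≃ₐ[HS φ] HS φ' :=
    { RingEquiv.ofRingHom p q hpq hqp with
      commutes' := fun x ↦ hp x }
  exact IsLocalization.isLocalization_of_algEquiv (Submonoid.powers (const φ r)) e

end HasseSchmidt

namespace ArcSpace

open Scheme AffineZariskiSite

variable {k : Type u} [CommRing k] {X Y : Scheme.{u}} (s : X ⟶ Spec (CommRingCat.of k))

/-- The `k`-algebra structure on the sections of a `k`-scheme `s : X ⟶ Spec k`. -/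
noncomputable def scalars (U : X.Opens) : k →+* Γ(X, U) :=
  RingHom.comp (s.appLE ⊤ U (show U ≤ s ⁻¹ᵁ ⊤ from le_top)).hom (ΓSpecIso (CommRingCat.of k)).inv.hom

lemma map_comp_scalars {U V : X.Opens} (i : V ⟶ U) :
    (X.presheaf.map i.op).hom.comp (scalars s U) = scalars s V := by
  rw [scalars, scalars, ← RingHom.comp_assoc, ← CommRingCat.hom_comp, Scheme.Hom.appLE_map]

lemma app_comp_scalars (f : Y ⟶ X) (U : X.Opens) :
    (f.app U).hom.comp (scalars s U) = scalars (f ≫ s) (f ⁻¹ᵁ U) := by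
  rw [scalars, scalars, ← RingHom.comp_assoc, ← CommRingCat.hom_comp]
  congr 2
  rw [Scheme.Hom.app_eq_appLE, Scheme.Hom.appLE_comp_appLE]

/-- The coordinate ring of the arc space of the affine open `U`. -/
noncomputable abbrev arcAlgebra (U : X.AffineZariskiSite) : CommRingCat.{u} :=
  .of (HasseSchmidt.HS (scalars s U.toOpens))

/-- The `𝒪_X`-algebra `U ↦ HS(Γ(X, U))` on the affine opens of `X`. -/
noncomputable def arcPresheaf : X.AffineZariskiSiteᵒᵖ ⥤ CommRingCat.{u} where
  obj U := arcAlgebra s U.unop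
  map i := CommRingCat.ofHom (HasseSchmidt.map (X.presheaf.map ((toOpensFunctor X).map i.unop).op).hom
    (map_comp_scalars s ((toOpensFunctor X).map i.unop)))
  map_id U := by
    apply CommRingCat.hom_ext
    refine HasseSchmidt.hom_ext fun n a ↦ ?_
    refine (HasseSchmidt.map_D _ (map_comp_scalars s _) n a).trans ?_
    exact congr(HasseSchmidt.D _ n ($(X.presheaf.map_id (.op U.unop.toOpens)).hom a))
  map_comp {U V W} i j := by
    apply CommRingCat.hom_ext
    refine HasseSchmidt.hom_ext fun n a ↦ ?_
    refine (HasseSchmidt.map_D _ (map_comp_scalars s _) n a).trans ?_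
    refine .trans ?_ (congr($(HasseSchmidt.map_comp_map _
      (map_comp_scalars s ((toOpensFunctor X).map i.unop)) _
      (map_comp_scalars s ((toOpensFunctor X).map j.unop)) (by
        rw [RingHom.comp_assoc, map_comp_scalars, map_comp_scalars]))
        (HasseSchmidt.D _ n a))).symm
    refine .trans ?_ (HasseSchmidt.map_D _ _ n a).symm
    exact congr(HasseSchmidt.D _ n ($(X.presheaf.map_comp
      ((toOpensFunctor X).map i.unop).op ((toOpensFunctor X).map j.unop).op).hom a))

/-- The structure map `Γ(X, U) → HS(Γ(X, U))`, `a ↦ D_0(a)`. -/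
noncomputable def arcPresheafMap : (toOpensFunctor X).op ⋙ X.presheaf ⟶ arcPresheaf s where
  app U := CommRingCat.ofHom (HasseSchmidt.const (scalars s U.unop.toOpens))
  naturality U V i := by
    apply CommRingCat.hom_ext
    exact (HasseSchmidt.map_comp_const _
      (map_comp_scalars s ((toOpensFunctor X).map i.unop))).symm

lemma coequifibered_arcPresheafMap : (arcPresheafMap s).Coequifibered := by
  rw [coequifibered_iff_forall_isLocalizationAway]
  intro U r
  exact HasseSchmidt.isLocalizationAway (X.presheaf.map (homOfLE (X.basicOpen_le r)).op).hom
    (map_comp_scalars s (homOfLE (X.basicOpen_le r))) r (U.2.isLocalization_basicOpen r)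

/-- The arc spaces `Spec HS(Γ(X, U))` of the affine opens `U` of `X`, with their gluing data over `X`. -/
noncomputable def glueData : (directedCover X).RelativeGluingData :=
  relativeGluingData (coequifibered_arcPresheafMap s)

instance : ((glueData s).functor ⋙ Scheme.forget).IsLocallyDirected :=
  Cover.RelativeGluingData.instIsLocallyDirectedI₀CompFunctorForgetOfIsThin ..

/-- The space of arcs `X_∞` of a `k`-scheme `s : X ⟶ Spec k`, glued from the arc spaces
`U_∞ = Spec HS(Γ(X, U))` of the affine opens `U` of `X`. -/
noncomputable def arcSpace : Scheme.{u} := (glueData s).glued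

/-- The projection `π_X : X_∞ ⟶ X`, `α ↦ α(0)`. -/
noncomputable def arcProj : arcSpace s ⟶ X := (glueData s).toBase

/-- The open immersion `U_∞ ⟶ X_∞`, for `U` an affine open of `X`. -/
noncomputable def chart (U : X.AffineZariskiSite) :
    Spec (arcAlgebra s U) ⟶ arcSpace s :=
  (glueData s).cover.f U

instance (U : X.AffineZariskiSite) : IsOpenImmersion (chart s U) :=
  (glueData s).cover.map_prop U

lemma chart_arcProj (U : X.AffineZariskiSite) :
    chart s U ≫ arcProj s =
      Spec.map (CommRingCat.ofHom (HasseSchmidt.const (scalars s U.toOpens))) ≫ U.2.fromSpec := by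
  exact colimit.ι_desc _ _

lemma opensRange_chart (U : X.AffineZariskiSite) :
    (chart s U).opensRange = arcProj s ⁻¹ᵁ U.toOpens := by
  refine ((glueData s).toBase_preimage_eq_opensRange_ι U).symm.trans ?_
  exact congr((glueData s).toBase ⁻¹ᵁ $(U.toOpens.opensRange_ι))

/-- The map `U_∞ ⟶ V_∞` for affine opens `U ≤ V`. -/
noncomputable def restrict {U V : X.AffineZariskiSite} (i : U ⟶ V) :
    Spec (arcAlgebra s U) ⟶ Spec (arcAlgebra s V) :=
  Spec.map (CommRingCat.ofHom (HasseSchmidt.map (X.presheaf.map ((toOpensFunctor X).map i).op).hom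
    (map_comp_scalars s ((toOpensFunctor X).map i))))

lemma restrict_chart {U V : X.AffineZariskiSite} (i : U ⟶ V) :
    restrict s i ≫ chart s V = chart s U :=
  colimit.w (glueData s).functor i

section Functoriality

variable (f : Y ⟶ X) [IsAffineHom f]

/-- The preimage of an affine open under an affine morphism. -/
def preimage (U : X.AffineZariskiSite) : Y.AffineZariskiSite :=
  ⟨f ⁻¹ᵁ U.toOpens, U.2.preimage f⟩

lemma preimage_mono : Monotone (preimage f) := by
  rintro U V ⟨r, hr⟩
  refine ⟨f.app V.toOpens r, ?_⟩
  refine (f.preimage_basicOpen r).symm.trans ?_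
  exact congr(f ⁻¹ᵁ $hr)

/-- The map `(f⁻¹ U)_∞ ⟶ U_∞` induced by `f`, for `U` an affine open of `X`. -/
noncomputable def localArcMap (U : X.AffineZariskiSite) :
    Spec (arcAlgebra (f ≫ s) (preimage f U)) ⟶
      Spec (arcAlgebra s U) :=
  Spec.map (CommRingCat.ofHom (HasseSchmidt.map (f.app U.toOpens).hom
    (app_comp_scalars s f U.toOpens)))

lemma map_localArcMap {U V : X.AffineZariskiSite} (i : U ⟶ V) :
    restrict (f ≫ s) (homOfLE (preimage_mono f i.le)) ≫ localArcMap s f V =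
      localArcMap s f U ≫ restrict s i := by
  refine (Spec.map_comp _ _).symm.trans (.trans ?_ (Spec.map_comp _ _))
  congr 1
  apply CommRingCat.hom_ext
  refine HasseSchmidt.hom_ext fun n a ↦ ?_
  have h₁ := map_comp_scalars (f ≫ s)
    ((toOpensFunctor Y).map (homOfLE (preimage_mono f i.le)))
  have h₂ := map_comp_scalars s ((toOpensFunctor X).map i)
  have e₁ := congr($(HasseSchmidt.map_comp_map _ (app_comp_scalars s f V.toOpens) _ h₁ (
    (congr_arg _ (app_comp_scalars s f V.toOpens)).trans h₁)) (HasseSchmidt.D _ n a))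
  have e₂ := congr($(HasseSchmidt.map_comp_map _ h₂ _ (app_comp_scalars s f U.toOpens)
    ((congr_arg _ h₂).trans (app_comp_scalars s f U.toOpens))) (HasseSchmidt.D _ n a))
  refine (e₁.trans (HasseSchmidt.map_D _ _ n a)).trans
    (.trans ?_ (e₂.trans (HasseSchmidt.map_D _ _ n a)).symm)
  exact congr(HasseSchmidt.D _ n ($(f.naturality ((toOpensFunctor X).map i).op).hom a)).symm

/-- The identification of `(π_Y ≫ f)⁻¹ U` with `(f⁻¹ U)_∞` as open subschemes of `Y_∞`. -/
noncomputable def toChart (U : X.AffineZariskiSite) :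
    pullback (arcProj (f ≫ s) ≫ f) U.toOpens.ι ⟶
      Spec (arcAlgebra (f ≫ s) (preimage f U)) :=
  IsOpenImmersion.lift (chart (f ≫ s) (preimage f U)) (pullback.fst _ _) (by
    rw [← Scheme.Hom.coe_opensRange, ← Scheme.Hom.coe_opensRange, opensRange_chart]
    rintro _ ⟨x, rfl⟩
    change f (arcProj (f ≫ s) (pullback.fst (arcProj (f ≫ s) ≫ f) U.toOpens.ι x)) ∈ U.toOpens
    rw [← Scheme.Hom.comp_apply, ← Scheme.Hom.comp_apply, pullback.condition]
    exact (pullback.snd (arcProj (f ≫ s) ≫ f) U.toOpens.ι x).2)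

lemma toChart_chart (U : X.AffineZariskiSite) :
    toChart s f U ≫ chart (f ≫ s) (preimage f U) = pullback.fst _ _ :=
  IsOpenImmersion.lift_fac ..

lemma arcMap_aux {U V : X.AffineZariskiSite} (i : U ⟶ V)
    (j : pullback (arcProj (f ≫ s) ≫ f) U.toOpens.ι ⟶
      pullback (arcProj (f ≫ s) ≫ f) V.toOpens.ι)
    (hj : j ≫ pullback.fst _ _ = pullback.fst _ _) :
    j ≫ toChart s f V ≫ localArcMap s f V ≫ chart s V =
      toChart s f U ≫ localArcMap s f U ≫ chart s U := by
  rw [← restrict_chart s i, ← Category.assoc (localArcMap s f U), ← map_localArcMap]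
  simp only [← Category.assoc]
  congr 2
  rw [← cancel_mono (chart (f ≫ s) (preimage f V)), Category.assoc, Category.assoc,
    restrict_chart, toChart_chart, toChart_chart, hj]

/-- The morphism `f_∞ : Y_∞ ⟶ X_∞`, `α ↦ f ∘ α`, induced by an affine morphism `f : Y ⟶ X` of
`k`-schemes, where `Y` is a `k`-scheme through `f`. It is glued from the maps
`(f⁻¹ U)_∞ ⟶ U_∞`, `D_n(a) ↦ D_n(f^* a)`; see `chart_arcMap`. -/
noncomputable def arcMap : arcSpace (f ≫ s) ⟶ arcSpace s :=
  Scheme.OpenCover.glueMorphismsOfLocallyDirected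
    ((directedCover X).pullback₁ (arcProj (f ≫ s) ≫ f))
    (fun U ↦ toChart s f U ≫ localArcMap s f U ≫ chart s U) fun i ↦
  arcMap_aux s f i _ (Cover.trans_map ((directedCover X).pullback₁ (arcProj (f ≫ s) ≫ f)) i)

lemma fst_arcMap (U : X.AffineZariskiSite) :
    pullback.fst (arcProj (f ≫ s) ≫ f) U.toOpens.ι ≫ arcMap s f =
      toChart s f U ≫ localArcMap s f U ≫ chart s U :=
  Scheme.OpenCover.map_glueMorphismsOfLocallyDirected
    ((directedCover X).pullback₁ (arcProj (f ≫ s) ≫ f))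
    (fun U ↦ toChart s f U ≫ localArcMap s f U ≫ chart s U) (fun i ↦ arcMap_aux s f i _
      (Cover.trans_map ((directedCover X).pullback₁ (arcProj (f ≫ s) ≫ f)) i)) U

lemma chart_arcMap (U : X.AffineZariskiSite) :
    chart (f ≫ s) (preimage f U) ≫ arcMap s f = localArcMap s f U ≫ chart s U := by
  let j : Spec (arcAlgebra (f ≫ s) (preimage f U)) ⟶
      pullback (arcProj (f ≫ s) ≫ f) U.toOpens.ι :=
    pullback.lift (chart (f ≫ s) (preimage f U))
      (IsOpenImmersion.lift U.toOpens.ι (chart (f ≫ s) (preimage f U) ≫ arcProj (f ≫ s) ≫ f) (by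
        rintro _ ⟨x, rfl⟩
        have hx : chart (f ≫ s) (preimage f U) x ∈ (chart (f ≫ s) (preimage f U)).opensRange :=
          ⟨x, rfl⟩
        rw [opensRange_chart] at hx
        rw [Scheme.Opens.range_ι]
        exact hx))
      (IsOpenImmersion.lift_fac ..).symm
  have hj : j ≫ pullback.fst _ _ = chart (f ≫ s) (preimage f U) := pullback.lift_fst ..
  have hj' : j ≫ toChart s f U = 𝟙 _ := by
    rw [← cancel_mono (chart (f ≫ s) (preimage f U)), Category.assoc, toChart_chart, hj,
      Category.id_comp]
  rw [← hj, Category.assoc, fst_arcMap, ← Category.assoc, hj', Category.id_comp]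

lemma localArcMap_const (U : X.AffineZariskiSite) :
    localArcMap s f U ≫ Spec.map (CommRingCat.ofHom (HasseSchmidt.const (scalars s U.toOpens))) =
      Spec.map (CommRingCat.ofHom (HasseSchmidt.const (scalars (f ≫ s) (preimage f U).toOpens))) ≫
        Spec.map (f.appLE U.toOpens (preimage f U).toOpens le_rfl) := by
  rw [← Spec.map_comp]
  refine (Spec.map_comp _ _).symm.trans (congr_arg Spec.map (CommRingCat.hom_ext ?_))
  exact (HasseSchmidt.map_comp_const _ (app_comp_scalars s f U.toOpens)).trans
    congr((HasseSchmidt.const (scalars (f ≫ s) (preimage f U).toOpens)).comp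
      ($(f.app_eq_appLE (U := U.toOpens))).hom)

lemma localArcMap_chart_arcProj (U : X.AffineZariskiSite) :
    localArcMap s f U ≫ chart s U ≫ arcProj s =
      chart (f ≫ s) (preimage f U) ≫ arcProj (f ≫ s) ≫ f := by
  rw [chart_arcProj, ← Category.assoc (chart _ _), chart_arcProj, ← Category.assoc,
    localArcMap_const, Category.assoc, Category.assoc,
    U.2.SpecMap_appLE_fromSpec f (preimage f U).2 le_rfl]

lemma arcMap_arcProj_aux (U : X.AffineZariskiSite) :
    pullback.fst (arcProj (f ≫ s) ≫ f) U.toOpens.ι ≫ arcMap s f ≫ arcProj s =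
      pullback.fst (arcProj (f ≫ s) ≫ f) U.toOpens.ι ≫ arcProj (f ≫ s) ≫ f := by
  rw [← Category.assoc, fst_arcMap, Category.assoc, Category.assoc, localArcMap_chart_arcProj,
    ← Category.assoc, toChart_chart]

lemma arcMap_arcProj : arcMap s f ≫ arcProj s = arcProj (f ≫ s) ≫ f := by
  refine Scheme.Cover.hom_ext ((directedCover X).pullback₁ (arcProj (f ≫ s) ≫ f)) _ _ fun U ↦ ?_
  exact arcMap_arcProj_aux s f U

end Functoriality

section Normalization

/-- The normalization of an integral separated scheme: the relative normalization of `X` in (the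
spectrum of) its function field, the stalk at the generic point. -/
noncomputable def normalization (X : Scheme.{u}) [IsIntegral X] [X.IsSeparated] : Scheme.{u} :=
  (X.fromSpecStalk (genericPoint X)).normalization

/-- The normalization morphism. -/
noncomputable def normalizationMap (X : Scheme.{u}) [IsIntegral X] [X.IsSeparated] :
    normalization X ⟶ X :=
  (X.fromSpecStalk (genericPoint X)).fromNormalization

instance (X : Scheme.{u}) [IsIntegral X] [X.IsSeparated] : IsIntegralHom (normalizationMap X) :=
  inferInstanceAs (IsIntegralHom (X.fromSpecStalk (genericPoint X)).fromNormalization)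

end Normalization
end ArcSpace

/-!
The statement is local on `X`, so let `X = Spec A` with normalization `Y = Spec B` and let `p` be the
maximal ideal of `P`. The point `P` is not generic because its local ring is not a field, hence it is
closed. A point of `X_∞` is an arc `A → K⟦t⟧` over a field `K`. Write `Z q` for the set of arcs of `X`
that are induced by arcs of `Y` centered at a point `q` over `p` (`HasseSchmidt.arcImage`).

*The sets `Z q` cover the fiber.* An arc centered at `p` has for kernel either `p`, so that it is
constant and lifts to a constant arc at each `q`, or zero. In the second case it extends to the
fraction field, and since `K⟦t⟧` is integrally closed it lifts to `B`
(`exists_lift_of_isIntegral`, `HasseSchmidt.exists_mem_arcImage_and`).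

*Each `Z q` is irreducible.* The local ring of `Y` at `q` is a discrete valuation ring with residue
field `k`, so functions have Taylor expansions in a parameter `u` (`IsParameter.taylor`), and an
arc centered at `q` is determined by the image of `u`, which is an arbitrary series without constant
term. The arcs at `q` are therefore the image of the spectrum of a polynomial ring in countably many
variables (`exists_universal_arc`).

*Each `Z q` is closed, and there are no inclusions among them.* If `a ∈ A` lies in `q ^ (n + 1)`, then
`D_n(a)` vanishes on `Z q`. Conversely, these closed conditions detect `q`: take a non-constant arc
that lifts to an arc `β` centered at `q' ≠ q`, a common denominator `g ≠ 0` of `B` over `A`, and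
`b ∈ q` outside `q'`. If `e` is the order of `β(g)`, then `g b ^ (e + 1)` lies in `A ∩ q ^ (e + 1)`,
but its image under `β` still has order `e`, so that `D_e` of it does not vanish at the arc
(`HasseSchmidt.le_ker_of_mem_arcContact`). As constant arcs belong to every `Z q`, the set `Z q` is
cut out by these conditions in the fiber. Since the curve `Y` has a non-constant arc at each point,
the `Z q` are pairwise incomparable.

So the fiber is a finite union of closed irreducible sets without inclusions, which are its
irreducible components. The common denominator and the finiteness of the set of the `q` come from
the finiteness of `B` over `A` (`finite_of_isIntegrallyClosed`), which uses characteristic zero.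
-/

/-! ### Taylor expansion along a principal maximal ideal -/

section Taylor

variable {k R : Type*} [CommRing k] [CommRing R]

/-- `u` is a parameter at the rational point `c : R → k` of the `k`-algebra `ι : k → R`: the kernel
of `c` is generated by the non-zero-divisor `u`. -/
structure IsParameter (ι : k →+* R) (c : R →+* k) (u : R) : Prop where
  retraction (x : k) : c (ι x) = x
  map_self : c u = 0
  dvd (r : R) : c r = 0 → u ∣ r
  cancel (r s : R) : u * r = u * s → r = s

namespace IsParameter

variable {ι : k →+* R} {c : R →+* k} {u : R} (h : IsParameter ι c u)
include h

lemma exists_quotient (r : R) : ∃ s, r = ι (c r) + u * s := by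
  obtain ⟨s, hs⟩ := h.dvd (r - ι (c r)) (by rw [map_sub, h.retraction, sub_self])
  exact ⟨s, by rw [← hs]; ring⟩

/-- The shift `r ↦ (r - r(0)) / u`. -/
noncomputable def shift (r : R) : R := (h.exists_quotient r).choose

lemma eq_add_shift (r : R) : r = ι (c r) + u * h.shift r :=
  (h.exists_quotient r).choose_spec

lemma shift_eq {r s : R} {x : k} (e : r = ι x + u * s) : h.shift r = s := by
  have hx : c r = x := by rw [e]; simp [h.retraction, h.map_self]
  have := h.eq_add_shift r
  rw [hx] at this
  exact h.cancel _ _ (add_left_cancel (this.symm.trans e))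

/-- The underlying function of `IsParameter.taylor`. -/
noncomputable def taylorFun (r : R) : PowerSeries k := PowerSeries.mk fun n ↦ c (h.shift^[n] r)

lemma taylorFun_eq (r : R) :
    h.taylorFun r = PowerSeries.C (c r) + PowerSeries.X * h.taylorFun (h.shift r) := by
  ext n
  cases n with
  | zero => simp [taylorFun]
  | succ n => simp [taylorFun, PowerSeries.coeff_succ_X_mul]

lemma taylorFun_add (r s : R) : h.taylorFun (r + s) = h.taylorFun r + h.taylorFun s := by
  have key (r s : R) : h.shift (r + s) = h.shift r + h.shift s := by
    refine h.shift_eq (x := c r + c s) ?_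
    conv_lhs => rw [h.eq_add_shift r, h.eq_add_shift s]
    rw [map_add]; ring
  have key' (n : ℕ) (r s : R) : h.shift^[n] (r + s) = h.shift^[n] r + h.shift^[n] s := by
    induction n generalizing r s with
    | zero => rfl
    | succ n ih => simp only [Function.iterate_succ_apply, key, ih]
  ext n
  simp [taylorFun, key']

lemma taylorFun_const_mul (x : k) (r : R) :
    h.taylorFun (ι x * r) = PowerSeries.C x * h.taylorFun r := by
  have key (r : R) : h.shift (ι x * r) = ι x * h.shift r := by
    refine h.shift_eq (x := x * c r) ?_
    conv_lhs => rw [h.eq_add_shift r]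
    rw [map_mul]; ring
  have key' (n : ℕ) (r : R) : h.shift^[n] (ι x * r) = ι x * h.shift^[n] r := by
    induction n generalizing r with
    | zero => rfl
    | succ n ih => simp only [Function.iterate_succ_apply, key, ih]
  ext n
  simp [taylorFun, key', h.retraction]

lemma taylorFun_param_mul (r : R) : h.taylorFun (u * r) = PowerSeries.X * h.taylorFun r := by
  rw [taylorFun_eq, h.shift_eq (r := u * r) (s := r) (x := 0) (by simp)]
  simp [h.map_self]

omit h in
lemma _root_.PowerSeries.eq_zero_of_forall_X_pow_dvd {S : Type*} [CommRing S] (f : PowerSeries S)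
    (hf : ∀ n, PowerSeries.X ^ n ∣ f) : f = 0 := by
  ext n
  rw [map_zero]
  exact PowerSeries.X_pow_dvd_iff.mp (hf (n + 1)) n (Nat.lt_succ_self n)

lemma taylorFun_mul (r s : R) : h.taylorFun (r * s) = h.taylorFun r * h.taylorFun s := by
  rw [← sub_eq_zero]
  refine PowerSeries.eq_zero_of_forall_X_pow_dvd _ fun n ↦ ?_
  induction n generalizing r with
  | zero => simp
  | succ n ih =>
    have e : r * s = ι (c r) * s + u * (h.shift r * s) := by
      conv_lhs => rw [h.eq_add_shift r]
      ring
    have e' : h.taylorFun (r * s) - h.taylorFun r * h.taylorFun s =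
        PowerSeries.X * (h.taylorFun (h.shift r * s) - h.taylorFun (h.shift r) * h.taylorFun s) := by
      rw [e, taylorFun_add, taylorFun_const_mul, taylorFun_param_mul, h.taylorFun_eq r]
      ring
    rw [e', pow_succ']
    exact mul_dvd_mul_left _ (ih _)

/-- The Taylor expansion `R → k⟦t⟧` in the parameter `u`. -/
noncomputable def taylor : R →+* PowerSeries k where
  toFun := h.taylorFun
  map_one' := by
    have := h.taylorFun_const_mul 1 0
    have h0 : h.taylorFun 0 = 0 := by simpa using h.taylorFun_add 0 0
    have e := h.taylorFun_eq 1
    rwa [h.shift_eq (r := 1) (s := 0) (x := 1) (by simp), h0, mul_zero, add_zero, map_one,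
      map_one] at e
  map_mul' := h.taylorFun_mul
  map_zero' := by simpa using h.taylorFun_add 0 0
  map_add' := h.taylorFun_add

lemma taylor_eq (r : R) :
    h.taylor r = PowerSeries.C (c r) + PowerSeries.X * h.taylor (h.shift r) :=
  h.taylorFun_eq r

lemma taylor_const (x : k) : h.taylor (ι x) = PowerSeries.C x := by
  rw [taylor_eq, h.shift_eq (r := ι x) (s := 0) (x := x) (by simp), map_zero, mul_zero, add_zero,
    h.retraction]

lemma taylor_param : h.taylor u = PowerSeries.X := by
  rw [taylor_eq, h.shift_eq (r := u) (s := 1) (x := 0) (by simp), map_one, mul_one, h.map_self,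
    map_zero, zero_add]

lemma constantCoeff_taylor (r : R) : PowerSeries.constantCoeff (h.taylor r) = c r := by
  rw [taylor_eq]; simp

lemma pow_dvd_of_taylor_eq_zero (n : ℕ) (r : R) (hr : h.taylor r = 0) : u ^ n ∣ r := by
  induction n generalizing r with
  | zero => simp
  | succ n ih =>
    have hc : c r = 0 := by rw [← h.constantCoeff_taylor, hr, map_zero]
    have e := h.taylor_eq r
    rw [hr, hc, map_zero, zero_add] at e
    have hs : h.taylor (h.shift r) = 0 := by
      ext n
      have := congr(PowerSeries.coeff (n + 1) $e)
      rw [PowerSeries.coeff_succ_X_mul] at this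
      exact this.symm
    rw [h.eq_add_shift r, hc, map_zero, zero_add, pow_succ']
    exact mul_dvd_mul_left _ (ih _ hs)

/-- An arc centered at the rational point is determined by the image of the parameter. -/
lemma hom_ext_of_param {S : Type*} [CommRing S] {f g : R →+* PowerSeries S}
    (hι : ∀ x, f (ι x) = g (ι x)) (hu : f u = g u) (h0 : PowerSeries.constantCoeff (f u) = 0) :
    f = g := by
  ext1 r
  rw [← sub_eq_zero]
  refine PowerSeries.eq_zero_of_forall_X_pow_dvd _ fun n ↦ ?_
  induction n generalizing r with
  | zero => simp
  | succ n ih =>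
    have e : f r - g r = f u * (f (h.shift r) - g (h.shift r)) := by
      conv_lhs => rw [h.eq_add_shift r]
      rw [map_add, map_add, map_mul, map_mul, hι, ← hu]
      ring
    rw [e, pow_succ']
    exact mul_dvd_mul (PowerSeries.X_dvd_iff.mpr h0) (ih _)

end IsParameter
end Taylor

/-! ### Points of the arc space of an affine scheme -/

namespace HasseSchmidt

variable {k A B : Type u} [CommRing k] [CommRing A] [CommRing B] (φ : k →+* A)

/-- The arc `A → κ⟦t⟧` over the residue field `κ` of a point of `Spec (HS A)`. -/
noncomputable def arcAt (x : PrimeSpectrum (HS φ)) :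
    A →+* PowerSeries x.asIdeal.ResidueField :=
  (PowerSeries.map (algebraMap (HS φ) x.asIdeal.ResidueField)).comp (univ φ)

/-- The field of definition of `arcAt φ x` as an extension of `k`. -/
noncomputable def arcBase (x : PrimeSpectrum (HS φ)) : k →+* x.asIdeal.ResidueField :=
  (algebraMap (HS φ) x.asIdeal.ResidueField).comp ((proj φ).comp MvPolynomial.C)

lemma arcAt_comp (x : PrimeSpectrum (HS φ)) :
    (arcAt φ x).comp φ = PowerSeries.C.comp (arcBase φ x) := by
  ext1 c
  have := congr($(univ_comp φ) c)
  simp only [RingHom.comp_apply] at this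
  simp [arcAt, arcBase, this]

lemma coeff_arcAt_eq_zero_iff (x : PrimeSpectrum (HS φ)) (n : ℕ) (a : A) :
    PowerSeries.coeff n (arcAt φ x a) = 0 ↔ D φ n a ∈ x.asIdeal := by
  simp [arcAt, Ideal.algebraMap_residueField_eq_zero]

variable {K : Type u} [CommRing K] [IsDomain K] (χ : k →+* K)

/-- The point of `Spec (HS A)` defined by an arc `A → K⟦t⟧` over a domain `K`. -/
noncomputable def arcPoint (α : A →+* PowerSeries K) (h : α.comp φ = PowerSeries.C.comp χ) :
    PrimeSpectrum (HS φ) :=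
  PrimeSpectrum.comap (lift φ χ α h) ⊥

lemma D_mem_arcPoint_iff (α : A →+* PowerSeries K) (h : α.comp φ = PowerSeries.C.comp χ) (n : ℕ)
    (a : A) : D φ n a ∈ (arcPoint φ χ α h).asIdeal ↔ PowerSeries.coeff n (α a) = 0 := by
  change lift φ χ α h (D φ n a) ∈ (⊥ : Ideal K) ↔ _
  rw [lift_D, Ideal.mem_bot]

lemma arcPoint_arcAt (x : PrimeSpectrum (HS φ)) :
    arcPoint φ (arcBase φ x) (arcAt φ x) (arcAt_comp φ x) = x := by
  have : lift φ (arcBase φ x) (arcAt φ x) (arcAt_comp φ x) =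
      algebraMap (HS φ) x.asIdeal.ResidueField := hom_ext fun n a ↦ by simp [arcAt]
  rw [arcPoint, this]
  ext y
  exact Ideal.algebraMap_residueField_eq_zero

lemma const_comap_arcPoint (α : A →+* PowerSeries K) (h : α.comp φ = PowerSeries.C.comp χ) :
    (PrimeSpectrum.comap (const φ) (arcPoint φ χ α h)).asIdeal =
      RingHom.ker (PowerSeries.constantCoeff.comp α) := by
  ext a
  change const φ a ∈ (arcPoint φ χ α h).asIdeal ↔ _
  rw [const_apply, D_mem_arcPoint_iff, RingHom.mem_ker]
  simp

variable {φ} in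
lemma comap_map_arcPoint {φ' : k →+* B} (g : A →+* B) (hg : g.comp φ = φ')
    (β : B →+* PowerSeries K) (h : β.comp φ' = PowerSeries.C.comp χ)
    (h' : (β.comp g).comp φ = PowerSeries.C.comp χ) :
    PrimeSpectrum.comap (map g hg) (arcPoint φ' χ β h) = arcPoint φ χ (β.comp g) h' := by
  rw [arcPoint, ← PrimeSpectrum.comap_comp_apply, arcPoint]
  congr 1
  exact hom_ext fun n a ↦ by simp

end HasseSchmidt

/-! ### Finite birational extensions and the lifting of arcs -/

section Birational

variable {A B : Type*} [CommRing A] [IsDomain A] [CommRing B] [IsDomain B]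

omit [IsDomain B] in
/-- A finite birational extension `B` of `A` has a nonzero conductor element. -/
lemma exists_common_denominator {ψ : A →+* B} (hfin : ψ.Finite)
    (hbir : ∀ b, ∃ g ≠ 0, ∃ a, ψ a = ψ g * b) : ∃ g ≠ 0, ∀ b, ∃ a, ψ a = ψ g * b := by
  let := ψ.toAlgebra
  obtain ⟨s, hs⟩ : (⊤ : Submodule A B).FG := hfin.1
  choose d hd n hn using hbir
  refine ⟨∏ b ∈ s, d b, Finset.prod_ne_zero_iff.mpr fun b _ ↦ hd b, fun b ↦ ?_⟩
  have hb : b ∈ Submodule.span A (s : Set B) := hs ▸ Submodule.mem_top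
  induction hb using Submodule.span_induction with
  | mem x hx =>
    obtain ⟨c, hc⟩ := Finset.dvd_prod_of_mem d hx
    exact ⟨n x * c, by rw [hc, map_mul, map_mul, hn]; ring⟩
  | zero => exact ⟨0, by simp⟩
  | add x y _ _ hx hy =>
    obtain ⟨a, ha⟩ := hx
    obtain ⟨a', ha'⟩ := hy
    exact ⟨a + a', by rw [map_add, ha, ha']; ring⟩
  | smul r x _ hx =>
    obtain ⟨a, ha⟩ := hx
    exact ⟨r * a, by rw [map_mul, ha, Algebra.smul_def, RingHom.algebraMap_toAlgebra]; ring⟩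

omit [IsDomain A] in
/-- A birational extension has the same fraction field. -/
lemma isFractionRing_of_birational [Algebra A B] (hinj : Function.Injective (algebraMap A B))
    (hbir : ∀ b, ∃ g ≠ 0, ∃ a, algebraMap A B a = algebraMap A B g * b)
    (L : Type*) [Field L] [Algebra A L] [Algebra B L] [IsScalarTower A B L] [IsFractionRing B L] :
    IsFractionRing A L := by
  have hAL := IsScalarTower.algebraMap_apply A B L
  have hL : Function.Injective (algebraMap A L) := by
    rw [IsScalarTower.algebraMap_eq A B L]
    exact (IsFractionRing.injective B L).comp hinj
  have : FaithfulSMul A L := (faithfulSMul_iff_algebraMap_injective A L).mpr hL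
  refine IsFractionRing.of_field A L fun z ↦ ?_
  obtain ⟨x, y, hy, rfl⟩ := IsFractionRing.div_surjective (A := B) z
  obtain ⟨g, hg, a, ha⟩ := hbir x
  obtain ⟨g', hg', a', ha'⟩ := hbir y
  have h1 : algebraMap A L g ≠ 0 := (map_ne_zero_iff _ hL).mpr hg
  have h2 : algebraMap A L g' ≠ 0 := (map_ne_zero_iff _ hL).mpr hg'
  have h3 : algebraMap B L y ≠ 0 := IsFractionRing.to_map_ne_zero_of_mem_nonZeroDivisors hy
  refine ⟨a * g', g * a', ?_⟩
  rw [map_mul, map_mul, hAL a, hAL a', ha, ha', map_mul, map_mul, ← hAL, ← hAL,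
    div_eq_div_iff h3 (mul_ne_zero h1 (mul_ne_zero h2 h3))]
  ring

omit [IsDomain A] in
/-- Integral birational extensions do not change the arcs that are injective on functions. -/
lemma exists_lift_of_isIntegral {ψ : A →+* B} (hinj : Function.Injective ψ) (hint : ψ.IsIntegral)
    (hbir : ∀ b, ∃ g ≠ 0, ∃ a, ψ a = ψ g * b) {S : Type*} [CommRing S] [IsDomain S]
    [IsIntegrallyClosed S] {α : A →+* S} (hα : Function.Injective α) :
    ∃ β : B →+* S, β.comp ψ = α := by
  let F := FractionRing S
  let L := FractionRing B
  let := ψ.toAlgebra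
  have : IsFractionRing A L := isFractionRing_of_birational hinj hbir L
  have hAL (a : A) : algebraMap A L a = algebraMap B L (ψ a) :=
    IsScalarTower.algebraMap_apply A B L a
  have hαF : Function.Injective ((algebraMap S F).comp α) :=
    (IsFractionRing.injective S F).comp hα
  let δ : B →+* F := (IsFractionRing.lift (K := L) hαF).comp (algebraMap B L)
  have hδ (a : A) : δ (ψ a) = algebraMap S F (α a) :=
    (congrArg _ (hAL a).symm).trans (IsFractionRing.lift_algebraMap (K := L) hαF a)
  have hr (b : B) : ∃ y, algebraMap S F y = δ b := by
    rw [← IsIntegrallyClosed.isIntegral_iff]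
    obtain ⟨p, hp, hpb⟩ := hint b
    refine ⟨p.map α, hp.map α, ?_⟩
    rw [Polynomial.eval₂_map]
    have e : (algebraMap S F).comp α = δ.comp ψ := by ext a; exact (hδ a).symm
    rw [e, ← Polynomial.hom_eval₂, hpb, map_zero]
  choose β hβ using hr
  have hi := IsFractionRing.injective S F
  refine ⟨⟨⟨⟨β, hi ?_⟩, fun x y ↦ hi ?_⟩, hi ?_, fun x y ↦ hi ?_⟩, ?_⟩
  · simp [hβ]
  · simp [hβ]
  · simp [hβ]
  · simp [hβ]
  · ext1 a
    refine hi ?_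
    change algebraMap S F (β (ψ a)) = _
    rw [hβ, hδ]

end Birational

/-- Hilbert's Nullstellensatz: the residue fields of an algebra of finite type over an algebraically
closed field `k` are `k`. -/
lemma exists_retraction_of_isMaximal {k A : Type*} [Field k] [IsAlgClosed k] [CommRing A]
    {φ : k →+* A} (hφ : φ.FiniteType) (p : Ideal A) [p.IsMaximal] :
    ∃ ε : A →+* k, RingHom.ker ε = p ∧ ∀ c, ε (φ c) = c := by
  let := φ.toAlgebra
  have : Algebra.FiniteType k A := hφ
  let : Field (A ⧸ p) := Ideal.Quotient.field p
  have : Algebra.FiniteType k (A ⧸ p) := .of_surjective (Ideal.Quotient.mkₐ k p)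
    (Ideal.Quotient.mkₐ_surjective k p)
  have : Module.Finite k (A ⧸ p) := finite_of_finite_type_of_isJacobsonRing k (A ⧸ p)
  let e := RingEquiv.ofBijective _
    (IsAlgClosed.algebraMap_bijective_of_isIntegral (k := k) (K := A ⧸ p))
  refine ⟨e.symm.toRingHom.comp (Ideal.Quotient.mk p), ?_, fun c ↦ ?_⟩
  · ext a
    simp [RingHom.mem_ker, Ideal.Quotient.eq_zero_iff_mem]
  · exact e.symm_apply_apply c

/-! ### Arcs on a smooth curve -/

section Smooth

variable {k B : Type u} [Field k] [CommRing B] [IsDedekindDomain B]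

/-- The local ring of a smooth curve at a closed point is a discrete valuation ring with residue
field `k`, so it has a parameter. -/
lemma exists_isParameter {φ : k →+* B} {q : Ideal B} [q.IsMaximal] (hq : q ≠ ⊥) {ε : B →+* k}
    (hε : RingHom.ker ε = q) (hεφ : ∀ c, ε (φ c) = c) :
    ∃ (c : Localization.AtPrime q →+* k) (u : Localization.AtPrime q),
      (∀ b, c (algebraMap B _ b) = ε b) ∧
      IsParameter ((algebraMap B (Localization.AtPrime q)).comp φ) c u := by
  let R := Localization.AtPrime q
  have hu (y : q.primeCompl) : IsUnit (ε y) := by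
    rw [isUnit_iff_ne_zero]
    intro h
    exact y.2 (hε ▸ h)
  let c : R →+* k := IsLocalization.lift hu
  have hc (b : B) : c (algebraMap B _ b) = ε b := IsLocalization.lift_eq hu b
  have : IsDiscreteValuationRing R :=
    IsLocalization.AtPrime.isDiscreteValuationRing_of_dedekind_domain B hq R
  obtain ⟨u, hu⟩ := IsDiscreteValuationRing.exists_irreducible R
  have hcs : Function.Surjective c := fun x ↦ ⟨algebraMap B _ (φ x), by rw [hc, hεφ]⟩
  have hker : RingHom.ker c = Ideal.span {u} := by
    rw [← hu.maximalIdeal_eq]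
    exact IsLocalRing.eq_maximalIdeal (RingHom.ker_isMaximal_of_surjective c hcs)
  refine ⟨c, u, hc, ⟨fun x ↦ by rw [RingHom.comp_apply, hc, hεφ], ?_, fun r hr ↦ ?_,
    fun r s h ↦ mul_left_cancel₀ hu.ne_zero h⟩⟩
  · rw [← RingHom.mem_ker, hker]
    exact Ideal.mem_span_singleton_self u
  · rw [← Ideal.mem_span_singleton, ← hker]
    exact hr

/-- A smooth curve has an arc at each of its points that is not constant. -/
lemma exists_injective_arc {φ : k →+* B} {q : Ideal B} [q.IsMaximal] (hq : q ≠ ⊥) {ε : B →+* k}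
    (hε : RingHom.ker ε = q) (hεφ : ∀ c, ε (φ c) = c) :
    ∃ τ : B →+* PowerSeries k, Function.Injective τ ∧
      τ.comp φ = PowerSeries.C.comp (RingHom.id k) ∧
      RingHom.ker (PowerSeries.constantCoeff.comp τ) = q := by
  obtain ⟨c, u, hc, h⟩ := exists_isParameter hq hε hεφ
  refine ⟨h.taylor.comp (algebraMap B _), ?_, ?_, ?_⟩
  · rw [injective_iff_map_eq_zero]
    intro b hb
    have hb' : algebraMap B (Localization.AtPrime q) b ∈
        ⨅ n, Ideal.span {u} ^ n := by
      rw [Submodule.mem_iInf]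
      intro n
      rw [Ideal.span_singleton_pow, Ideal.mem_span_singleton]
      exact h.pow_dvd_of_taylor_eq_zero n _ hb
    have hne : Ideal.span {u} ≠ ⊤ := by
      intro htop
      have h1 : (1 : Localization.AtPrime q) ∈ Ideal.span {u} := htop ▸ Submodule.mem_top
      obtain ⟨v, hv⟩ := Ideal.mem_span_singleton.mp h1
      have := congr(c $hv)
      simp [h.map_self] at this
    rw [Ideal.iInf_pow_eq_bot_of_isDomain _ hne, Ideal.mem_bot] at hb'
    exact (map_eq_zero_iff _ (IsLocalization.injective _ q.primeCompl_le_nonZeroDivisors)).mp hb'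
  · ext1 x
    exact h.taylor_const x
  · refine Eq.trans ?_ hε
    ext b
    simp [RingHom.mem_ker, h.constantCoeff_taylor, hc]

/-- The universal arc centered at a point of a smooth curve: its coefficient ring is a polynomial
ring in the coefficients of the image of a parameter. -/
lemma exists_universal_arc {φ : k →+* B} {q : Ideal B} [q.IsMaximal] (hq : q ≠ ⊥) {ε : B →+* k}
    (hε : RingHom.ker ε = q) (hεφ : ∀ c, ε (φ c) = c) :
    ∃ γ : B →+* PowerSeries (MvPolynomial ℕ k),
      γ.comp φ = PowerSeries.C.comp MvPolynomial.C ∧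
      RingHom.ker (PowerSeries.constantCoeff.comp γ) = q ∧
      ∀ (K : Type u) [Field K] (χ : k →+* K) (β : B →+* PowerSeries K),
        β.comp φ = PowerSeries.C.comp χ → RingHom.ker (PowerSeries.constantCoeff.comp β) = q →
        ∃ θ : MvPolynomial ℕ k →+* K, θ.comp MvPolynomial.C = χ ∧
          (PowerSeries.map θ).comp γ = β := by
  obtain ⟨c, u, hc, h⟩ := exists_isParameter hq hε hεφ
  -- the universal series without constant term, substituted for the parameter
  let w : PowerSeries (MvPolynomial ℕ k) := PowerSeries.X * PowerSeries.mk MvPolynomial.X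
  have hw0 : PowerSeries.constantCoeff w = 0 := by simp [w]
  have hw : PowerSeries.HasSubst w := .of_constantCoeff_zero' hw0
  let σ : PowerSeries k →+* PowerSeries (MvPolynomial ℕ k) :=
    (PowerSeries.substAlgHom (R := k) hw : PowerSeries k →ₐ[k] PowerSeries (MvPolynomial ℕ k))
  have hσX : σ PowerSeries.X = w := PowerSeries.substAlgHom_X hw
  have hσC (x : k) : σ (PowerSeries.C x) = PowerSeries.C (MvPolynomial.C x) :=
    ((PowerSeries.substAlgHom (R := k) hw).commutes x).trans <| by
      rw [MvPowerSeries.algebraMap_apply, MvPolynomial.algebraMap_eq]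
      rfl
  have hσ0 (f : PowerSeries k) : PowerSeries.constantCoeff (σ f) =
      MvPolynomial.C (PowerSeries.constantCoeff f) := by
    have e := PowerSeries.sub_const_eq_X_mul_shift f
    rw [sub_eq_iff_eq_add] at e
    conv_lhs => rw [e]
    rw [map_add, map_mul, hσX, hσC, map_add, map_mul, hw0, zero_mul, zero_add,
      PowerSeries.constantCoeff_C]
  let γ' : Localization.AtPrime q →+* PowerSeries (MvPolynomial ℕ k) := σ.comp h.taylor
  have hγC (x : k) : γ' (algebraMap B _ (φ x)) = PowerSeries.C (MvPolynomial.C x) :=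
    (congrArg σ (h.taylor_const x)).trans (hσC x)
  have hγu : γ' u = w := (congrArg σ h.taylor_param).trans hσX
  refine ⟨γ'.comp (algebraMap B _), RingHom.ext hγC, ?_, fun K _ χ β hβ hβq ↦ ?_⟩
  · refine Eq.trans ?_ hε
    ext b
    rw [RingHom.mem_ker, RingHom.mem_ker]
    change PowerSeries.constantCoeff (σ (h.taylor _)) = 0 ↔ _
    rw [hσ0, h.constantCoeff_taylor, hc, map_eq_zero_iff _ (MvPolynomial.C_injective _ _)]
  · have hunit (y : q.primeCompl) : IsUnit (β y) := by
      rw [PowerSeries.isUnit_iff_constantCoeff, isUnit_iff_ne_zero]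
      intro h0
      exact y.2 (hβq ▸ h0)
    let β' : Localization.AtPrime q →+* PowerSeries K := IsLocalization.lift hunit
    have hβ' (b : B) : β' (algebraMap B _ b) = β b := IsLocalization.lift_eq hunit b
    -- the parameter is not a unit of the local ring, and `β'` is a local homomorphism
    have hβu : PowerSeries.constantCoeff (β' u) = 0 := by
      obtain ⟨b, y, e⟩ := IsLocalization.exists_mk'_eq q.primeCompl u
      have e1 : u * algebraMap B _ y = algebraMap B _ b := by
        rw [← e, IsLocalization.mk'_spec]
      have hb : b ∈ q := by
        rw [← hε, RingHom.mem_ker, ← hc, ← e1, map_mul, h.map_self, zero_mul]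
      have hb' : PowerSeries.constantCoeff (β b) = 0 := by
        rw [← hβq] at hb
        exact hb
      have e2 := congr(PowerSeries.constantCoeff (β' $e1))
      rw [map_mul, map_mul, hβ', hβ', hb'] at e2
      refine (mul_eq_zero.mp e2).resolve_right ?_
      rw [← ne_eq, ← isUnit_iff_ne_zero, ← PowerSeries.isUnit_iff_constantCoeff]
      exact hunit y
    let θ : MvPolynomial ℕ k →+* K :=
      MvPolynomial.eval₂Hom χ fun n ↦ PowerSeries.coeff (n + 1) (β' u)
    have hθ : θ.comp MvPolynomial.C = χ := by ext x; simp [θ]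
    have hβφ (x : k) : β (φ x) = PowerSeries.C (χ x) := congr($hβ x)
    have key : (PowerSeries.map θ).comp γ' = β' := by
      refine h.hom_ext_of_param (fun x ↦ ?_) ?_ ?_
      · change PowerSeries.map θ (γ' (algebraMap B _ (φ x))) = β' (algebraMap B _ (φ x))
        rw [hγC, hβ', hβφ, PowerSeries.map_C]
        exact congrArg _ congr($hθ x)
      · rw [RingHom.comp_apply, hγu]
        ext n
        cases n with
        | zero => simp [w, hβu]
        | succ n => simp [w, θ, PowerSeries.coeff_succ_X_mul]
      · rw [RingHom.comp_apply, hγu]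
        simp [w]
    refine ⟨θ, hθ, ?_⟩
    ext1 b
    rw [← hβ', ← key]
    rfl

/-- The fiber of the arc space of a smooth curve over a point is irreducible. -/
lemma isIrreducible_fiber_of_isDedekindDomain {φ : k →+* B} {q : PrimeSpectrum B}
    [q.asIdeal.IsMaximal] (hq : q.asIdeal ≠ ⊥) {ε : B →+* k}
    (hε : RingHom.ker ε = q.asIdeal) (hεφ : ∀ c, ε (φ c) = c) :
    IsIrreducible (PrimeSpectrum.comap (HasseSchmidt.const φ) ⁻¹' {q}) := by
  obtain ⟨γ, hγ, hγ0, H⟩ := exists_universal_arc hq hε hεφ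
  let l := HasseSchmidt.lift φ MvPolynomial.C γ hγ
  have : PrimeSpectrum.comap (HasseSchmidt.const φ) ⁻¹' {q} = Set.range (PrimeSpectrum.comap l) := by
    ext x
    constructor
    · intro hx
      have hx0 : RingHom.ker (PowerSeries.constantCoeff.comp (HasseSchmidt.arcAt φ x)) =
          q.asIdeal := by
        rw [← HasseSchmidt.const_comap_arcPoint φ _ _ (HasseSchmidt.arcAt_comp φ x),
          HasseSchmidt.arcPoint_arcAt, Set.mem_singleton_iff.mp hx]
      obtain ⟨θ, hθ, e⟩ := H _ _ _ (HasseSchmidt.arcAt_comp φ x) hx0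
      refine ⟨PrimeSpectrum.comap θ ⊥, ?_⟩
      rw [← PrimeSpectrum.comap_comp_apply]
      refine Eq.trans ?_ (HasseSchmidt.arcPoint_arcAt φ x)
      rw [HasseSchmidt.arcPoint]
      congr 1
      exact HasseSchmidt.hom_ext fun n a ↦ by simp [l, ← e]
    · rintro ⟨y, rfl⟩
      rw [Set.mem_preimage, Set.mem_singleton_iff, ← PrimeSpectrum.comap_comp_apply]
      have : l.comp (HasseSchmidt.const φ) = MvPolynomial.C.comp ε := by
        have hc (x : k) : PowerSeries.constantCoeff (γ (φ x)) = MvPolynomial.C x := by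
          have := congr(PowerSeries.constantCoeff ($hγ x))
          simpa using this
        ext1 b
        have hb : b - φ (ε b) ∈ q.asIdeal := by rw [← hε, RingHom.mem_ker]; simp [hεφ]
        rw [← hγ0, RingHom.mem_ker, RingHom.comp_apply, map_sub, map_sub, hc, sub_eq_zero] at hb
        simpa [l] using hb
      rw [this]
      have h1 : q.asIdeal ≤ (PrimeSpectrum.comap (MvPolynomial.C.comp ε) y).asIdeal := by
        rw [← hε]
        intro b hb
        change MvPolynomial.C (ε b) ∈ y.asIdeal
        rw [RingHom.mem_ker.mp hb, map_zero]
        exact y.asIdeal.zero_mem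
      exact PrimeSpectrum.ext
        (Ideal.IsMaximal.eq_of_le ‹_› (PrimeSpectrum.isPrime _).ne_top h1).symm
  rw [this, ← Set.image_univ]
  exact (IrreducibleSpace.isIrreducible_univ _).image _
    (PrimeSpectrum.continuous_comap l).continuousOn

end Smooth

/-! ### Arcs on a curve and on its normalization -/

namespace HasseSchmidt

section

variable {k A B : Type u} [CommRing k] [CommRing A] [CommRing B]
  {φ : k →+* A} {φ' : k →+* B} {ψ : A →+* B} (h : ψ.comp φ = φ')

/-- The set of arcs on `Spec A` that are induced by arcs on `Spec B` centered at `q`. -/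
def arcImage (q : PrimeSpectrum B) : Set (PrimeSpectrum (HS φ)) :=
  PrimeSpectrum.comap (map ψ h) '' (PrimeSpectrum.comap (const φ') ⁻¹' {q})

variable (φ ψ) in
/-- The set of arcs on `Spec A` along which every function of `A` that vanishes to order `> n` at
`q ∈ Spec B` has vanishing `n`-th coefficient, for all `n`. -/
def arcContact (q : PrimeSpectrum B) : Set (PrimeSpectrum (HS φ)) :=
  {x | ∀ n a, ψ a ∈ q.asIdeal ^ (n + 1) → D φ n a ∈ x.asIdeal}

lemma isClosed_arcContact (q : PrimeSpectrum B) : IsClosed (arcContact φ ψ q) := by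
  have : arcContact φ ψ q =
      PrimeSpectrum.zeroLocus {y | ∃ n a, ψ a ∈ q.asIdeal ^ (n + 1) ∧ y = D φ n a} := by
    ext x
    rw [PrimeSpectrum.mem_zeroLocus]
    constructor
    · rintro hx _ ⟨n, a, ha, rfl⟩
      exact hx n a ha
    · intro hx n a ha
      exact hx ⟨n, a, ha, rfl⟩
  rw [this]
  exact PrimeSpectrum.isClosed_zeroLocus _

lemma ker_constantCoeff_arcAt (x : PrimeSpectrum (HS φ)) :
    RingHom.ker (PowerSeries.constantCoeff.comp (arcAt φ x)) =
      (PrimeSpectrum.comap (const φ) x).asIdeal := by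
  rw [← const_comap_arcPoint φ _ _ (arcAt_comp φ x), arcPoint_arcAt]

lemma arcImage_subset_fiber (q : PrimeSpectrum B) :
    arcImage h q ⊆ PrimeSpectrum.comap (const φ) ⁻¹' {PrimeSpectrum.comap ψ q} := by
  rintro _ ⟨y, hy, rfl⟩
  rw [Set.mem_preimage, Set.mem_singleton_iff, ← PrimeSpectrum.comap_comp_apply, map_comp_const,
    PrimeSpectrum.comap_comp_apply, Set.mem_singleton_iff.mp hy]

lemma arcPoint_mem_arcImage {K : Type u} [CommRing K] [IsDomain K] {χ : k →+* K}
    {β : B →+* PowerSeries K} (hβ : β.comp φ' = PowerSeries.C.comp χ)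
    (hβ' : (β.comp ψ).comp φ = PowerSeries.C.comp χ) {q : PrimeSpectrum B}
    (hq : RingHom.ker (PowerSeries.constantCoeff.comp β) = q.asIdeal) :
    arcPoint φ χ (β.comp ψ) hβ' ∈ arcImage h q := by
  rw [← comap_map_arcPoint χ ψ h β hβ hβ']
  refine ⟨_, ?_, rfl⟩
  rw [Set.mem_preimage, Set.mem_singleton_iff]
  exact PrimeSpectrum.ext ((const_comap_arcPoint ..).trans hq)

/-- An arc centered at `q` sends `q ^ (n + 1)` into `(t ^ (n + 1))`. -/
lemma arcImage_subset_arcContact (q : PrimeSpectrum B) :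
    arcImage h q ⊆ arcContact φ ψ q := by
  rintro _ ⟨y, hy, rfl⟩ n a ha
  change map ψ h (D φ n a) ∈ y.asIdeal
  rw [map_D, ← coeff_arcAt_eq_zero_iff]
  refine PowerSeries.X_pow_dvd_iff.mp ?_ n (Nat.lt_succ_self n)
  rw [← Ideal.mem_span_singleton, ← Ideal.span_singleton_pow]
  have hle : q.asIdeal.map (arcAt φ' y) ≤ Ideal.span {PowerSeries.X} := by
    rw [Ideal.map_le_iff_le_comap]
    intro b hb
    rw [Ideal.mem_comap, Ideal.mem_span_singleton, PowerSeries.X_dvd_iff]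
    rw [← Set.mem_singleton_iff.mp hy, ← ker_constantCoeff_arcAt] at hb
    exact hb
  refine Ideal.pow_right_mono hle (n + 1) ?_
  rw [← Ideal.map_pow]
  exact Ideal.mem_map_of_mem _ ha

/-- The branches of a curve are separated by their contact conditions: if an arc of `Spec B` that
does not meet the non-isomorphism locus identically has contact with `q`, then it is centered
at `q`. For `b ∈ q` not vanishing at the center of the arc `β` and a common denominator `g` of `B`
whose image along `β` has order `e`, the function `g * b ^ (e + 1)` of `A` vanishes to order `> e`
at `q`, while its image along `β` has order `e`. -/
lemma le_ker_of_mem_arcContact {K : Type u} [Field K] {χ : k →+* K}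
    {β : B →+* PowerSeries K}
    (hβ' : (β.comp ψ).comp φ = PowerSeries.C.comp χ) {g : A}
    (hg : ∀ b, ∃ a, ψ a = ψ g * b) (hβg : β (ψ g) ≠ 0) {q : PrimeSpectrum B}
    (hq : arcPoint φ χ (β.comp ψ) hβ' ∈ arcContact φ ψ q) :
    q.asIdeal ≤ RingHom.ker (PowerSeries.constantCoeff.comp β) := by
  intro b hb
  by_contra hb0
  have hb0' : PowerSeries.constantCoeff (β b) ≠ 0 := hb0
  let e := (β (ψ g)).order.toNat
  obtain ⟨a, ha⟩ := hg (b ^ (e + 1))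
  have h0 := hq e a (by rw [ha]; exact Ideal.mul_mem_left _ _ (Ideal.pow_mem_pow hb _))
  rw [D_mem_arcPoint_iff, RingHom.comp_apply, ha, map_mul, map_pow] at h0
  have hu : IsUnit (β b ^ (e + 1)) :=
    (PowerSeries.isUnit_iff_constantCoeff.mpr (isUnit_iff_ne_zero.mpr hb0')).pow _
  have ho : (β (ψ g) * β b ^ (e + 1)).order = (β (ψ g)).order := by
    rw [PowerSeries.order_mul, PowerSeries.order_zero_of_unit hu, add_zero]
  have hne : β (ψ g) * β b ^ (e + 1) ≠ 0 := mul_ne_zero hβg hu.ne_zero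
  exact PowerSeries.coeff_order hne (by rw [ho]; exact h0)

end

variable {k A B : Type u} [Field k] [IsAlgClosed k] [CommRing A] [IsDomain A] [CommRing B]
  [IsDedekindDomain B] [Ring.DimensionLEOne A]
  {φ : k →+* A} {φ' : k →+* B} {ψ : A →+* B} (h : ψ.comp φ = φ')
  (hφ : φ.FiniteType) (hinj : Function.Injective ψ) (hfin : ψ.Finite)
  (hbir : ∀ b, ∃ g ≠ 0, ∃ a, ψ a = ψ g * b)

include hinj in
omit [IsDomain A] [Ring.DimensionLEOne A] in
lemma isMaximal_of_comap {p : PrimeSpectrum A} (hp : p.asIdeal ≠ ⊥) {q : PrimeSpectrum B}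
    (hq : PrimeSpectrum.comap ψ q = p) : q.asIdeal.IsMaximal ∧ q.asIdeal ≠ ⊥ := by
  have hq0 : q.asIdeal ≠ ⊥ := by
    rintro h0
    refine hp (le_bot_iff.mp fun a ha ↦ ?_)
    rw [← hq] at ha
    have ha' : ψ a ∈ q.asIdeal := ha
    rw [h0, Ideal.mem_bot] at ha'
    exact hinj (ha'.trans (map_zero ψ).symm)
  exact ⟨q.isPrime.isMaximal hq0, hq0⟩

include h hφ hfin in
omit [IsDomain A] [Ring.DimensionLEOne A] [IsDedekindDomain B] in
lemma exists_retraction {q : PrimeSpectrum B} (hq : q.asIdeal.IsMaximal) :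
    ∃ ε : B →+* k, RingHom.ker ε = q.asIdeal ∧ ∀ c, ε (φ' c) = c := by
  subst h
  exact exists_retraction_of_isMaximal ((RingHom.FiniteType.of_finite hfin).comp hφ) q.asIdeal

include h hφ hinj hfin in
omit [IsDomain A] [Ring.DimensionLEOne A] in
lemma isIrreducible_arcImage {p : PrimeSpectrum A} (hp : p.asIdeal ≠ ⊥)
    {q : PrimeSpectrum B} (hq : PrimeSpectrum.comap ψ q = p) :
    IsIrreducible (arcImage h q) := by
  obtain ⟨hqm, hq0⟩ := isMaximal_of_comap hinj hp hq
  obtain ⟨ε, hε, hεφ⟩ := exists_retraction h hφ hfin hqm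
  exact (isIrreducible_fiber_of_isDedekindDomain hq0 hε hεφ).image _
    (PrimeSpectrum.continuous_comap _).continuousOn

include hφ hinj hfin hbir

/-- An arc centered at a closed point `p` of a curve is either constant, and then it lifts to a
constant arc at every point over `p`, or injective on functions, and then it lifts to the
normalization by integrality; the center of this lift is the only point over `p` with which the arc
has contact. -/
lemma exists_mem_arcImage_and {p : PrimeSpectrum A} (hp : p.asIdeal ≠ ⊥)
    {x : PrimeSpectrum (HS φ)} (hx : PrimeSpectrum.comap (const φ) x = p) :
    (∀ q, PrimeSpectrum.comap ψ q = p → x ∈ arcImage h q) ∨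
    ∃ q, PrimeSpectrum.comap ψ q = p ∧ x ∈ arcImage h q ∧
      ∀ q' : PrimeSpectrum B, PrimeSpectrum.comap ψ q' = p → x ∈ arcContact φ ψ q' → q' = q := by
  set α := arcAt φ x with hα
  have hαφ := arcAt_comp φ x
  have hαp : RingHom.ker (PowerSeries.constantCoeff.comp α) = p.asIdeal := by
    rw [hα, ker_constantCoeff_arcAt, hx]
  by_cases hαi : Function.Injective α
  · right
    obtain ⟨g, hg0, hg⟩ := exists_common_denominator hfin hbir
    obtain ⟨β, hβ⟩ := exists_lift_of_isIntegral hinj hfin.to_isIntegral hbir hαi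
    have hβφ : β.comp φ' = PowerSeries.C.comp (arcBase φ x) := by
      rw [← h, ← RingHom.comp_assoc, hβ, hα, hαφ]
    have hβφ' : (β.comp ψ).comp φ = PowerSeries.C.comp (arcBase φ x) := by
      rw [hβ, hα, hαφ]
    have hxβ : x = arcPoint φ (arcBase φ x) (β.comp ψ) hβφ' := by
      simp_rw [hβ]
      exact (arcPoint_arcAt φ x).symm
    let q : PrimeSpectrum B :=
      ⟨RingHom.ker (PowerSeries.constantCoeff.comp β), RingHom.ker_isPrime _⟩
    have hqx : x ∈ arcImage h q := hxβ ▸ arcPoint_mem_arcImage h hβφ hβφ' rfl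
    refine ⟨q, ?_, hqx, fun q' hq' hxq' ↦ ?_⟩
    · have := arcImage_subset_fiber h q hqx
      rw [Set.mem_preimage, Set.mem_singleton_iff] at this
      rw [← this, hx]
    · have hβg : β (ψ g) ≠ 0 := by
        rw [← RingHom.comp_apply, hβ]
        exact (map_ne_zero_iff α hαi).mpr hg0
      refine PrimeSpectrum.ext ((isMaximal_of_comap hinj hp hq').1.eq_of_le
        q.isPrime.ne_top ?_)
      exact le_ker_of_mem_arcContact hβφ' hg hβg (hxβ ▸ hxq')
  · left
    intro q hq
    have hqm := isMaximal_of_comap hinj hp hq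
    obtain ⟨ε, hε, hεφ⟩ := exists_retraction h hφ hfin hqm.1
    -- a nonzero prime of `A` is maximal, so the arc factors through the residue field `k` of `p`
    have hker : RingHom.ker α = p.asIdeal := by
      have h0 : RingHom.ker α ≠ ⊥ := fun h0 ↦ hαi ((RingHom.injective_iff_ker_eq_bot α).mpr h0)
      have : (RingHom.ker α).IsPrime := RingHom.ker_isPrime α
      refine (this.isMaximal h0).eq_of_le p.isPrime.ne_top ?_
      rw [← hαp]
      intro a ha
      rw [RingHom.mem_ker] at ha ⊢
      rw [RingHom.comp_apply, ha, map_zero]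
    let β : B →+* PowerSeries x.asIdeal.ResidueField :=
      PowerSeries.C.comp ((arcBase φ x).comp ε)
    have hβφ : β.comp φ' = PowerSeries.C.comp (arcBase φ x) := by
      ext1 c
      simp [β, hεφ]
    have hβα : β.comp ψ = α := by
      ext1 a
      have ha : a - φ (ε (ψ a)) ∈ p.asIdeal := by
        rw [← hq]
        change ψ _ ∈ q.asIdeal
        have e (c : k) : ψ (φ c) = φ' c := congr($h c)
        rw [← hε, RingHom.mem_ker, map_sub, e, map_sub, hεφ, sub_self]
      rw [← hker, RingHom.mem_ker, map_sub, sub_eq_zero] at ha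
      rw [ha]
      exact congr($hαφ (ε (ψ a))).symm
    have hβφ' : (β.comp ψ).comp φ = PowerSeries.C.comp (arcBase φ x) := by
      rw [hβα, hα, hαφ]
    have hxβ : x = arcPoint φ (arcBase φ x) (β.comp ψ) hβφ' := by
      simp_rw [hβα]
      exact (arcPoint_arcAt φ x).symm
    rw [hxβ]
    refine arcPoint_mem_arcImage h hβφ hβφ' ?_
    rw [← hε]
    ext b
    simp [RingHom.mem_ker, β]

/-- The arcs induced by arcs centered at `q` are cut out by their contact conditions. -/
lemma arcImage_eq_arcContact_inter {p : PrimeSpectrum A} (hp : p.asIdeal ≠ ⊥)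
    {q : PrimeSpectrum B} (hq : PrimeSpectrum.comap ψ q = p) :
    arcImage h q = arcContact φ ψ q ∩ PrimeSpectrum.comap (const φ) ⁻¹' {p} := by
  refine Set.Subset.antisymm (Set.subset_inter (arcImage_subset_arcContact h q) ?_) ?_
  · rw [← hq]
    exact arcImage_subset_fiber h q
  · rintro x ⟨hxq, hxp⟩
    obtain H | ⟨q', hq', hx, H⟩ := exists_mem_arcImage_and h hφ hinj hfin hbir hp hxp
    · exact H q hq
    · rwa [H q hq hxq]

lemma iUnion_arcImage {p : PrimeSpectrum A} (hp : p.asIdeal ≠ ⊥) :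
    ⋃ q ∈ PrimeSpectrum.comap ψ ⁻¹' {p}, arcImage h q =
      PrimeSpectrum.comap (const φ) ⁻¹' {p} := by
  refine Set.Subset.antisymm (Set.iUnion₂_subset fun q hq ↦ ?_) fun x hx ↦ ?_
  · rw [← Set.mem_singleton_iff.mp hq]
    exact arcImage_subset_fiber h q
  · rw [Set.mem_iUnion₂]
    obtain H | ⟨q, hq, hx, -⟩ := exists_mem_arcImage_and h hφ hinj hfin hbir hp hx
    · let := ψ.toAlgebra
      have : Algebra.IsIntegral A B := ⟨hfin.to_isIntegral⟩
      obtain ⟨Q, -, hQ, e⟩ := Ideal.exists_ideal_over_prime_of_isIntegral p.asIdeal (⊥ : Ideal B) (by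
        intro a ha
        have ha' : ψ a = 0 := ha
        rw [hinj (ha'.trans (map_zero ψ).symm)]
        exact zero_mem _)
      have hq : PrimeSpectrum.comap ψ ⟨Q, hQ⟩ = p := PrimeSpectrum.ext e
      exact ⟨⟨Q, hQ⟩, hq, H _ hq⟩
    · exact ⟨q, hq, hx⟩

omit [Ring.DimensionLEOne A] in
/-- Distinct points over `p` give incomparable sets of arcs: the smooth curve has a non-constant arc
at each point, and its contact conditions remember that point. -/
lemma eq_of_arcImage_subset {p : PrimeSpectrum A} (hp : p.asIdeal ≠ ⊥)
    {q q' : PrimeSpectrum B} (hq : PrimeSpectrum.comap ψ q = p)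
    (hq' : PrimeSpectrum.comap ψ q' = p) (hle : arcImage h q ⊆ arcImage h q') : q = q' := by
  obtain ⟨hqm, hq0⟩ := isMaximal_of_comap hinj hp hq
  obtain ⟨ε, hε, hεφ⟩ := exists_retraction h hφ hfin hqm
  obtain ⟨τ, hτ, hτφ, hτq⟩ := exists_injective_arc hq0 hε hεφ
  obtain ⟨g, hg0, hg⟩ := exists_common_denominator hfin hbir
  have hτφ' : (τ.comp ψ).comp φ = PowerSeries.C.comp (RingHom.id k) := by
    rw [RingHom.comp_assoc, h, hτφ]
  have hx := arcImage_subset_arcContact h q' (hle (arcPoint_mem_arcImage h hτφ hτφ' hτq))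
  have hτg : τ (ψ g) ≠ 0 := (map_ne_zero_iff τ hτ).mpr ((map_ne_zero_iff ψ hinj).mpr hg0)
  have := le_ker_of_mem_arcContact hτφ' hg hτg hx
  rw [hτq] at this
  exact (PrimeSpectrum.ext ((isMaximal_of_comap hinj hp hq').1.eq_of_le
    hqm.ne_top this)).symm

end HasseSchmidt

/-! ### The normalization of an affine curve -/

section NormalizationAlgebra

/-- The normalization of an integral algebra of finite type over a field of characteristic zero is
finite: by Noether normalization, it is the integral closure of a polynomial ring in a finite
separable extension. -/
lemma finite_of_isIntegrallyClosed {k A B : Type*} [Field k] [CharZero k] [CommRing A] [IsDomain A]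
    [CommRing B] [IsDomain B] [IsIntegrallyClosed B] {φ : k →+* A} {ψ : A →+* B}
    (hφ : φ.FiniteType) (hinj : Function.Injective ψ) (hint : ψ.IsIntegral)
    (hbir : ∀ b, ∃ g ≠ 0, ∃ a, ψ a = ψ g * b) : ψ.Finite := by
  let := φ.toAlgebra
  have : Algebra.FiniteType k A := hφ
  obtain ⟨s, g, hg, hgf⟩ := exists_finite_inj_algHom_of_fg k A
  let P := MvPolynomial (Fin s) k
  let := g.toRingHom.toAlgebra
  let := ψ.toAlgebra
  let : Algebra P B := (ψ.comp g.toRingHom).toAlgebra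
  have : IsScalarTower P A B := .of_algebraMap_eq' rfl
  have : Module.Finite P A := hgf
  have : Algebra.IsIntegral A B := ⟨hint⟩
  have : Algebra.IsIntegral P B := Algebra.IsIntegral.trans A
  have hPB : Function.Injective (algebraMap P B) := hinj.comp hg
  have : FaithfulSMul P B := (faithfulSMul_iff_algebraMap_injective P B).mpr hPB
  let K := FractionRing P
  let L := FractionRing B
  have hPL : Function.Injective (algebraMap P L) := by
    rw [IsScalarTower.algebraMap_eq P B L]
    exact (IsFractionRing.injective B L).comp hPB
  let : Algebra K L := FractionRing.liftAlgebra P L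
  have : IsScalarTower P K L := FractionRing.isScalarTower_liftAlgebra P L
  have : IsIntegralClosure B P L := IsIntegralClosure.of_isIntegrallyClosed B P L
  have : IsFractionRing A L := isFractionRing_of_birational hinj hbir L
  have : FaithfulSMul P A := (faithfulSMul_iff_algebraMap_injective P A).mpr hg
  have : IsScalarTower P A L := .of_algebraMap_eq' <| by
    rw [IsScalarTower.algebraMap_eq A B L, RingHom.comp_assoc, ← IsScalarTower.algebraMap_eq P A B,
      ← IsScalarTower.algebraMap_eq P B L]
  have : FiniteDimensional K L := Module.Finite.of_isLocalization P A (nonZeroDivisors P)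
  have : CharZero K := charZero_of_injective_algebraMap (R := k) (A := K) (RingHom.injective _)
  have : Module.Finite P B := IsIntegralClosure.finite P K L B
  exact Module.Finite.of_restrictScalars_finite P A B

lemma isDedekindDomain_of_finite {k A B : Type*} [Field k] [CommRing A] [IsDomain A]
    [Ring.DimensionLEOne A] [CommRing B] [IsDomain B] [IsIntegrallyClosed B] {φ : k →+* A}
    {ψ : A →+* B} (hφ : φ.FiniteType) (hfin : ψ.Finite) : IsDedekindDomain B := by
  have : IsNoetherianRing B := by
    let := (ψ.comp φ).toAlgebra
    have : Algebra.FiniteType k B := (RingHom.FiniteType.of_finite hfin).comp hφ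
    exact Algebra.FiniteType.isNoetherianRing k B
  have : Ring.DimensionLEOne B := by
    let := ψ.toAlgebra
    have : Algebra.IsIntegral A B := ⟨hfin.to_isIntegral⟩
    exact Ring.DimensionLEOne.of_isIntegral A B
  exact { }

lemma finite_fiber_of_finite {A B : Type*} [CommRing A] [CommRing B] {ψ : A →+* B}
    (hfin : ψ.Finite) (p : PrimeSpectrum A) : (PrimeSpectrum.comap ψ ⁻¹' {p}).Finite := by
  let := ψ.toAlgebra
  have : Module.Finite A B := hfin
  refine ((Algebra.QuasiFinite.finite_primesOver (S := B) p.asIdeal).preimage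
    (f := PrimeSpectrum.asIdeal) fun _ _ _ _ e ↦ PrimeSpectrum.ext e).subset fun q hq ↦ ?_
  exact ⟨q.isPrime, ⟨congrArg PrimeSpectrum.asIdeal (Set.mem_singleton_iff.mp hq).symm⟩⟩

variable {A B F : Type*} [CommRing A] [CommRing B] [Field F] [Algebra A F]
  [IsFractionRing A F] {ψ : A →+* B} {j : B →+* F}
  (hj : Function.Injective j) (hjψ : j.comp ψ = algebraMap A F)
include hj hjψ

lemma exists_smul_eq_of_isFractionRing (b : B) : ∃ g ≠ 0, ∃ a, ψ a = ψ g * b := by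
  have hjψ' (a : A) : j (ψ a) = algebraMap A F a := congr($hjψ a)
  have := (algebraMap A F).domain_nontrivial
  obtain ⟨a, g, hg, e⟩ := IsFractionRing.div_surjective (A := A) (j b)
  have hg0 : algebraMap A F g ≠ 0 := IsFractionRing.to_map_ne_zero_of_mem_nonZeroDivisors hg
  refine ⟨g, nonZeroDivisors.ne_zero hg, a, hj ?_⟩
  rw [map_mul, hjψ', hjψ', ← e, mul_div_cancel₀ _ hg0]

lemma isIntegrallyClosed_of_isFractionRing [IsDomain B] (hint : ψ.IsIntegral)
    (hsat : ∀ z : F, IsIntegral A z → ∃ b, j b = z) : IsIntegrallyClosed B := by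
  let := j.toAlgebra
  let := ψ.toAlgebra
  have : IsScalarTower A B F := .of_algebraMap_eq' hjψ.symm
  have : Algebra.IsIntegral A B := ⟨hint⟩
  have : FaithfulSMul B F := (faithfulSMul_iff_algebraMap_injective B F).mpr hj
  have : IsFractionRing B F := by
    refine IsFractionRing.of_field B F fun z ↦ ?_
    obtain ⟨a, g, -, e⟩ := IsFractionRing.div_surjective (A := A) z
    refine ⟨ψ a, ψ g, ?_⟩
    rw [← e]
    exact congr($(congr($hjψ a)) / $(congr($hjψ g))).symm
  rw [isIntegrallyClosed_iff F]
  intro z hz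
  exact hsat z (isIntegral_trans (R := A) (A := B) z hz)

end NormalizationAlgebra

/-! ### Irreducible components of a finite union -/

section Components

variable {T J : Type*} [TopologicalSpace T] {I : Set J} {W : J → Set T}

/-- A finite cover by closed irreducible subsets without inclusions among them consists of the
irreducible components. -/
lemma irreducibleComponents_eq_image (hI : I.Finite) (hcl : ∀ i ∈ I, IsClosed (W i))
    (hirr : ∀ i ∈ I, IsIrreducible (W i)) (hcov : ⋃ i ∈ I, W i = Set.univ)
    (hW : ∀ i ∈ I, ∀ j ∈ I, W i ⊆ W j → i = j) : irreducibleComponents T = W '' I := by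
  have key (S : Set T) (hS : IsIrreducible S) : ∃ i ∈ I, S ⊆ W i := by
    have := isIrreducible_iff_sUnion_isClosed.mp hS (hI.image W).toFinset
      (by simpa using hcl) (by
        rw [Set.Finite.coe_toFinset, Set.sUnion_image, hcov]
        exact Set.subset_univ S)
    simpa using this
  ext C
  constructor
  · intro hC
    obtain ⟨i, hi, hCi⟩ := key C hC.1
    exact ⟨i, hi, (hC.2 (hirr i hi) hCi).antisymm hCi⟩
  · rintro ⟨i, hi, rfl⟩
    refine ⟨hirr i hi, fun S hS hle ↦ ?_⟩
    obtain ⟨j, hj, hSj⟩ := key S hS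
    obtain rfl := hW i hi j hj (hle.trans hSj)
    exact hSj

/-- The version of `irreducibleComponents_eq_image` for a subspace. -/
lemma image_irreducibleComponents_eq_image {F : Set T} (hI : I.Finite)
    (hcl : ∀ i ∈ I, IsClosed (W i)) (hirr : ∀ i ∈ I, IsIrreducible (W i))
    (hcov : ⋃ i ∈ I, W i = F) (hW : ∀ i ∈ I, ∀ j ∈ I, W i ⊆ W j → i = j) :
    (fun C : Set F ↦ Subtype.val '' C) '' irreducibleComponents F = W '' I := by
  have hsub (i) (hi : i ∈ I) : W i ⊆ F := hcov ▸ Set.subset_biUnion_of_mem hi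
  have hval (i) (hi : i ∈ I) : (Subtype.val '' (Subtype.val ⁻¹' W i : Set F)) = W i := by
    rw [Subtype.image_preimage_coe, Set.inter_eq_right]
    exact hsub i hi
  rw [irreducibleComponents_eq_image (T := F) (W := fun i ↦ Subtype.val ⁻¹' W i) hI
    (fun i hi ↦ (hcl i hi).preimage continuous_subtype_val) ?_ ?_ ?_,
    Set.image_image]
  · exact Set.image_congr hval
  · refine fun i hi ↦ ⟨?_, ?_⟩
    · rw [← Set.image_nonempty (f := Subtype.val), hval i hi]
      exact (hirr i hi).nonempty
    · rintro _ _ ⟨u, hu, rfl⟩ ⟨v, hv, rfl⟩ ⟨x, hx, hxu⟩ ⟨y, hy, hyv⟩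
      obtain ⟨z, hz, hzuv⟩ := (hirr i hi).2 u v hu hv ⟨x, hx, hxu⟩ ⟨y, hy, hyv⟩
      exact ⟨⟨z, hsub i hi hz⟩, hz, hzuv⟩
  · rw [← Set.preimage_iUnion₂, hcov]
    exact Subtype.coe_preimage_self F
  · intro i hi j hj hij
    refine hW i hi j hj ?_
    rw [← hval i hi, ← hval j hj]
    exact Set.image_mono hij

end Components

/-- A closed subset of an open subspace is closed as soon as it is contained in a closed subset of the
ambient space that lies in the open subspace. -/
lemma Topology.IsOpenEmbedding.isClosed_image {S T : Type*} [TopologicalSpace S]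
    [TopologicalSpace T] {ι : S → T} (hι : Topology.IsOpenEmbedding ι) {Z : Set S}
    (hZ : IsClosed Z) {F : Set T} (hF : IsClosed F) (hFι : F ⊆ Set.range ι) (hZF : ι '' Z ⊆ F) :
    IsClosed (ι '' Z) := by
  rw [← isOpen_compl_iff]
  have : (ι '' Z)ᶜ = ι '' Zᶜ ∪ Fᶜ := by
    ext x
    constructor
    · intro hx
      by_cases hxF : x ∈ F
      · obtain ⟨y, rfl⟩ := hFι hxF
        exact Or.inl ⟨y, fun hy ↦ hx ⟨y, hy, rfl⟩, rfl⟩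
      · exact Or.inr hxF
    · rintro (⟨y, hy, rfl⟩ | hx) h
      · exact hy (hι.injective.mem_set_image.mp h)
      · exact hx (hZF h)
  rw [this]
  exact (hι.isOpenMap _ hZ.isOpen_compl).union hF.isOpen_compl

/-! ### Coordinate rings of affine opens of a curve -/

namespace ArcSpace

lemma finiteType_scalars {k : Type u} [CommRing k] {X : Scheme.{u}}
    (s : X ⟶ Spec (CommRingCat.of k)) [LocallyOfFiniteType s] {U : X.Opens} (hU : IsAffineOpen U) :
    (scalars s U).FiniteType := by
  refine RingHom.FiniteType.comp (LocallyOfFiniteType.finiteType_appLE s (isAffineOpen_top _) hU _)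
    (RingHom.FiniteType.of_surjective _ ?_)
  exact (Scheme.ΓSpecIso (CommRingCat.of k)).commRingCatIsoToRingEquiv.symm.surjective

lemma dimensionLEOne_of_isAffineOpen {X : Scheme.{u}} [IsIntegral X]
    (hdim : topologicalKrullDim X = 1) {U : X.Opens} (hU : IsAffineOpen U) [Nonempty U] :
    Ring.DimensionLEOne Γ(X, U) where
  maximalOfPrime := by
    intro p hp hprime
    have h1 : ringKrullDim Γ(X, U) ≤ 1 := by
      rw [← PrimeSpectrum.topologicalKrullDim_eq_ringKrullDim, ← hdim]
      exact hU.fromSpec.isOpenEmbedding.isInducing.topologicalKrullDim_le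
    have h2 : Ring.KrullDimLE 1 Γ(X, U) := Ring.krullDimLE_iff.mpr h1
    refine (Ring.krullDimLE_one_iff.mp h2 p hprime).resolve_left fun hmin ↦ hp ?_
    rw [IsDomain.minimalPrimes_eq_singleton_bot] at hmin
    exact hmin

/-- Ring-theoretic form of `exists_toFunctionField`: `N` is the integral closure of `A` in `G ≅ S`. -/
lemma exists_hom_of_iso_integralClosure {A N S G : CommRingCat.{u}} {a : A ⟶ G} {i : A ⟶ S}
    {κ : S ⟶ G} [IsIso κ] (hκ : a = i ≫ κ) {ψ : A ⟶ N}
    (e : letI := a.hom.toAlgebra; N ≅ CommRingCat.of (integralClosure A G))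
    (hψ : letI := a.hom.toAlgebra;
      ψ = CommRingCat.ofHom (algebraMap A (integralClosure A G)) ≫ e.inv) :
    ∃ j : N →+* S, Function.Injective j ∧ j.comp ψ.hom = i.hom ∧
      ∀ z : S, i.hom.IsIntegralElem z → ∃ b, j b = z := by
  let := a.hom.toAlgebra
  let C := integralClosure A G
  let c : CommRingCat.of C ⟶ G := CommRingCat.ofHom C.val.toRingHom
  have hκ' : Function.Injective (inv κ).hom :=
    (asIso κ).symm.commRingCatIsoToRingEquiv.injective
  refine ⟨(e.hom ≫ c ≫ inv κ).hom, ?_, ?_, fun z hz ↦ ?_⟩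
  · exact hκ'.comp (Subtype.val_injective.comp e.commRingCatIsoToRingEquiv.injective)
  · have : ψ ≫ e.hom ≫ c ≫ inv κ = i := by
      rw [← Category.assoc, (Iso.eq_comp_inv _).mp hψ, ← Category.assoc, IsIso.comp_inv_eq, ← hκ]
      rfl
    exact congr(($this).hom)
  · have hz' : IsIntegral A (κ.hom z) := by
      obtain ⟨p, hp, hpz⟩ := hz
      refine ⟨p, hp, ?_⟩
      have hκ'' : algebraMap A G = κ.hom.comp i.hom := congr(($hκ).hom)
      rw [hκ'', ← Polynomial.hom_eval₂, hpz, map_zero]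
    refine ⟨e.inv.hom ⟨κ.hom z, hz'⟩, ?_⟩
    have : e.inv ≫ e.hom ≫ c ≫ inv κ = c ≫ inv κ := by simp
    refine (congr(($this).hom ⟨κ.hom z, hz'⟩)).trans ?_
    exact congr(($(IsIso.hom_inv_id κ)).hom z)

/-- The sections of the normalization over an affine open `U` are the rational functions that are
integral over `Γ(X, U)`. The normalization is built from sections over `Spec K(X)`, which are
identified here with the function field `K(X)` itself. -/
lemma exists_toFunctionField (X : Scheme.{u}) [IsIntegral X] [X.IsSeparated] {U : X.Opens}
    (hU : IsAffineOpen U) [Nonempty U] :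
    ∃ j : Γ(normalization X, normalizationMap X ⁻¹ᵁ U) →+* X.functionField,
      Function.Injective j ∧
      j.comp ((normalizationMap X).app U).hom = algebraMap Γ(X, U) X.functionField ∧
      ∀ z : X.functionField, IsIntegral Γ(X, U) z → ∃ b, j b = z := by
  let g := X.fromSpecStalk (genericPoint X)
  have hη : genericPoint X ∈ U :=
    ((genericPoint_spec X).mem_open_set_iff U.isOpen).mpr (by simpa using ‹Nonempty U›)
  -- `Spec K(X)` is a point, mapped to the generic point of `X`
  have htop : g ⁻¹ᵁ U = ⊤ := Scheme.preimage_eq_top_of_closedPoint_mem (f := g) <| by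
    rw [Scheme.fromSpecStalk_closedPoint]
    exact hη
  let S := X.presheaf.stalk (genericPoint X)
  let κ : S ⟶ Γ(Spec S, g ⁻¹ᵁ U) :=
    (Scheme.ΓSpecIso S).inv ≫ (Spec S).presheaf.map (homOfLE le_top).op
  have : IsIso κ := by
    have : IsIso (homOfLE (le_top : g ⁻¹ᵁ U ≤ ⊤)) :=
      ⟨homOfLE htop.ge, Subsingleton.elim _ _, Subsingleton.elim _ _⟩
    infer_instance
  have hκ : g.app U = X.presheaf.germ U (genericPoint X) hη ≫ κ := Scheme.fromSpecStalk_app hη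
  exact exists_hom_of_iso_integralClosure hκ (g.normalizationObjIso hU) (g.fromNormalization_app hU)

/-! ### Closed points of a curve and the charts of its arc space -/

section Curve

variable {X : Scheme.{u}} [IsIntegral X]

lemma ne_genericPoint_of_not_isRegularLocalRing {P : X}
    (hP : ¬ IsRegularLocalRing (X.presheaf.stalk P)) : P ≠ genericPoint X := by
  rintro rfl
  exact hP (inferInstanceAs (IsRegularLocalRing X.functionField))

lemma primeIdealOf_ne_bot {P : X} (hP : P ≠ genericPoint X) {U : X.Opens} (hU : IsAffineOpen U)
    (hPU : P ∈ U) : (hU.primeIdealOf ⟨P, hPU⟩).asIdeal ≠ ⊥ := by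
  intro h0
  have : Nonempty U := ⟨P, hPU⟩
  have h1 := hU.primeIdealOf_genericPoint
  have h2 : hU.primeIdealOf ⟨P, hPU⟩ = genericPoint (Spec Γ(X, U)) := by
    rw [genericPoint_eq_bot_of_affine]
    exact PrimeSpectrum.ext h0
  have h3 := congr(hU.fromSpec $(h2.trans h1.symm))
  rw [hU.fromSpec_primeIdealOf, hU.fromSpec_primeIdealOf] at h3
  exact hP h3

/-- If `P` specializes to `x`, then in an affine neighborhood of `x` the prime ideal of `P` is nonzero,
hence maximal, so `P = x`. -/
lemma isClosed_singleton_of_ne_genericPoint (hdim : topologicalKrullDim X = 1) {P : X}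
    (hP : P ≠ genericPoint X) : IsClosed ({P} : Set X) := by
  rw [← closure_subset_iff_isClosed]
  intro x hx
  rw [← specializes_iff_mem_closure] at hx
  obtain ⟨U, hU, hxU, -⟩ := exists_isAffineOpen_mem_and_subset (x := x) (U := ⊤) trivial
  have hPU : P ∈ U := hx.mem_open U.isOpen hxU
  have : Nonempty U := ⟨P, hPU⟩
  have := dimensionLEOne_of_isAffineOpen hdim hU
  have h0 := primeIdealOf_ne_bot hP hU hPU
  have hle : hU.primeIdealOf ⟨P, hPU⟩ ≤ hU.primeIdealOf ⟨x, hxU⟩ := by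
    rw [PrimeSpectrum.le_iff_specializes]
    refine hU.fromSpec.isOpenEmbedding.isInducing.specializes_iff.mp ?_
    rwa [hU.fromSpec_primeIdealOf, hU.fromSpec_primeIdealOf]
  have e : hU.primeIdealOf ⟨P, hPU⟩ = hU.primeIdealOf ⟨x, hxU⟩ :=
    PrimeSpectrum.ext (((PrimeSpectrum.isPrime _).isMaximal h0).eq_of_le
      (PrimeSpectrum.isPrime _).ne_top hle)
  have e' := congr(hU.fromSpec $e)
  rw [hU.fromSpec_primeIdealOf, hU.fromSpec_primeIdealOf] at e'
  exact e'.symm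

end Curve

section Charts

open Scheme AffineZariskiSite

variable {k : Type u} [CommRing k] {X Y : Scheme.{u}} (s : X ⟶ Spec (CommRingCat.of k))

lemma preimage_fromSpec_eq_image_chart (U : X.AffineZariskiSite)
    (p : PrimeSpectrum Γ(X, U.toOpens)) :
    arcProj s ⁻¹' {U.2.fromSpec p} = chart s U ''
      (PrimeSpectrum.comap (HasseSchmidt.const (scalars s U.toOpens)) ⁻¹' {p}) := by
  have h (y) : arcProj s (chart s U y) =
      U.2.fromSpec (PrimeSpectrum.comap (HasseSchmidt.const (scalars s U.toOpens)) y) := by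
    rw [← Scheme.Hom.comp_apply, chart_arcProj]
    rfl
  ext x
  constructor
  · intro hx
    have hxr : x ∈ (chart s U).opensRange := by
      rw [opensRange_chart]
      change arcProj s x ∈ U.toOpens
      rw [Set.mem_singleton_iff.mp hx]
      exact U.2.range_fromSpec.subset ⟨p, rfl⟩
    obtain ⟨y, rfl⟩ := hxr
    refine ⟨y, ?_, rfl⟩
    rw [Set.mem_preimage, h] at hx
    exact U.2.fromSpec.isOpenEmbedding.injective hx
  · rintro ⟨y, hy, rfl⟩
    rw [Set.mem_preimage, h, Set.mem_singleton_iff.mp hy]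
    rfl

variable (f : Y ⟶ X) [IsAffineHom f]

omit [IsAffineHom f] in
lemma apply_fromSpec {U : X.Opens} (hU : IsAffineOpen U) (hV : IsAffineOpen (f ⁻¹ᵁ U))
    (q : PrimeSpectrum Γ(Y, f ⁻¹ᵁ U)) :
    f (hV.fromSpec q) = hU.fromSpec (PrimeSpectrum.comap (f.app U).hom q) := by
  refine (Scheme.Hom.comp_apply hV.fromSpec f q).symm.trans ?_
  rw [← hU.SpecMap_appLE_fromSpec f hV le_rfl, Scheme.Hom.app_eq_appLE]
  rfl

omit [IsAffineHom f] in
lemma preimage_singleton_eq_image_fromSpec {U : X.Opens} (hU : IsAffineOpen U)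
    (hV : IsAffineOpen (f ⁻¹ᵁ U)) (p : PrimeSpectrum Γ(X, U)) :
    f ⁻¹' {hU.fromSpec p} = hV.fromSpec '' (PrimeSpectrum.comap (f.app U).hom ⁻¹' {p}) := by
  ext y
  constructor
  · intro hy
    have hyr : y ∈ Set.range hV.fromSpec := by
      rw [hV.range_fromSpec]
      change f y ∈ U
      rw [Set.mem_singleton_iff.mp hy]
      exact hU.range_fromSpec.subset ⟨p, rfl⟩
    obtain ⟨q, rfl⟩ := hyr
    refine ⟨q, ?_, rfl⟩
    exact hU.fromSpec.isOpenEmbedding.injective ((apply_fromSpec f hU hV q).symm.trans hy)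
  · rintro ⟨q, hq, rfl⟩
    exact (apply_fromSpec f hU hV q).trans (congrArg _ hq)

lemma arcMap_image_eq_chart_image (U : X.AffineZariskiSite)
    (q : PrimeSpectrum Γ(Y, f ⁻¹ᵁ U.toOpens)) :
    arcMap s f '' (arcProj (f ≫ s) ⁻¹' {(preimage f U).2.fromSpec q}) =
      chart s U '' HasseSchmidt.arcImage (app_comp_scalars s f U.toOpens) q := by
  have h (y) : arcMap s f (chart (f ≫ s) (preimage f U) y) = chart s U (PrimeSpectrum.comap
      (HasseSchmidt.map (f.app U.toOpens).hom (app_comp_scalars s f U.toOpens)) y) := by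
    rw [← Scheme.Hom.comp_apply, chart_arcMap]
    rfl
  have e := preimage_fromSpec_eq_image_chart (f ≫ s) (preimage f U) q
  ext x
  constructor
  · rintro ⟨z, hz, rfl⟩
    obtain ⟨y, hy, rfl⟩ := e.subset hz
    exact ⟨_, ⟨y, hy, rfl⟩, (h y).symm⟩
  · rintro ⟨_, ⟨y, hy, rfl⟩, rfl⟩
    exact ⟨_, e.superset ⟨y, hy, rfl⟩, h y⟩

end Charts

end ArcSpace

/-! ### Arcs centered at a singular point of a curve -/

theorem mainTheorem10 {k : Type u} [Field k] [IsAlgClosed k] [CharZero k]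
    (X : Scheme.{u}) (s : X ⟶ Spec (CommRingCat.of k))
    [IsIntegral X] [X.IsSeparated] [LocallyOfFiniteType s] [QuasiCompact s]
    (hdim : topologicalKrullDim X = 1)
    (P : X) (hP : ¬ IsRegularLocalRing (X.presheaf.stalk P)) :
    (ArcSpace.normalizationMap X ⁻¹' {P}).Finite ∧
    (irreducibleComponents (ArcSpace.arcProj s ⁻¹' {P} : Set (ArcSpace.arcSpace s))).encard =
      (ArcSpace.normalizationMap X ⁻¹' {P}).encard ∧
    ∀ Q : ArcSpace.normalization X, ArcSpace.normalizationMap X Q = P →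
      IsClosed (ArcSpace.arcMap s (ArcSpace.normalizationMap X) '' (ArcSpace.arcProj (ArcSpace.normalizationMap X ≫ s) ⁻¹' {Q})) ∧
      ArcSpace.arcMap s (ArcSpace.normalizationMap X) '' (ArcSpace.arcProj (ArcSpace.normalizationMap X ≫ s) ⁻¹' {Q}) ∈
        (fun C ↦ Subtype.val '' C) ''
          irreducibleComponents (ArcSpace.arcProj s ⁻¹' {P} : Set (ArcSpace.arcSpace s)) := by
  have hPη := ArcSpace.ne_genericPoint_of_not_isRegularLocalRing hP
  have hPc := ArcSpace.isClosed_singleton_of_ne_genericPoint hdim hPη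
  obtain ⟨U₀, hU₀, hPU, -⟩ := exists_isAffineOpen_mem_and_subset (x := P) (U := ⊤) trivial
  have : Nonempty U₀ := ⟨P, hPU⟩
  have := ArcSpace.dimensionLEOne_of_isAffineOpen hdim hU₀
  let U : X.AffineZariskiSite := ⟨U₀, hU₀⟩
  let f := ArcSpace.normalizationMap X
  let V := ArcSpace.preimage f U
  let p : PrimeSpectrum Γ(X, U₀) := hU₀.primeIdealOf ⟨P, hPU⟩
  have hp : U.2.fromSpec p = P := hU₀.fromSpec_primeIdealOf ⟨P, hPU⟩
  have hp0 : p.asIdeal ≠ ⊥ := ArcSpace.primeIdealOf_ne_bot hPη hU₀ hPU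
  have := functionField_isFractionRing_of_isAffineOpen X U₀ hU₀
  let ψ : Γ(X, U₀) →+* Γ(ArcSpace.normalization X, f ⁻¹ᵁ U₀) := (f.app U₀).hom
  obtain ⟨j, hj, hjψ, hsat⟩ := ArcSpace.exists_toFunctionField X hU₀
  have hφ := ArcSpace.finiteType_scalars s hU₀
  have h : ψ.comp (ArcSpace.scalars s U₀) = ArcSpace.scalars (f ≫ s) (f ⁻¹ᵁ U₀) :=
    ArcSpace.app_comp_scalars s f U₀
  have hB : IsDomain Γ(ArcSpace.normalization X, f ⁻¹ᵁ U₀) := hj.isDomain j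
  have hint : ψ.IsIntegral := IsIntegralHom.isIntegral_app f U₀ hU₀
  have hinj : Function.Injective ψ := by
    have : Function.Injective (j.comp ψ) := by
      rw [hjψ]
      exact IsFractionRing.injective _ _
    exact Function.Injective.of_comp (f := j) this
  have hbir := exists_smul_eq_of_isFractionRing hj hjψ
  have := isIntegrallyClosed_of_isFractionRing hj hjψ hint hsat
  have hfin : ψ.Finite := finite_of_isIntegrallyClosed hφ hinj hint hbir
  have := isDedekindDomain_of_finite hφ hfin
  let I : Set (PrimeSpectrum Γ(ArcSpace.normalization X, f ⁻¹ᵁ U₀)) := PrimeSpectrum.comap ψ ⁻¹' {p}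
  have hI : I.Finite := finite_fiber_of_finite hfin p
  have hfI : f ⁻¹' {P} = V.2.fromSpec '' I := by
    rw [← hp]
    exact ArcSpace.preimage_singleton_eq_image_fromSpec f hU₀ V.2 p
  have hF := ArcSpace.preimage_fromSpec_eq_image_chart s U p
  rw [hp] at hF
  have hι : Topology.IsOpenEmbedding (ArcSpace.chart s U) := (ArcSpace.chart s U).isOpenEmbedding
  let W (q : PrimeSpectrum Γ(ArcSpace.normalization X, f ⁻¹ᵁ U₀)) : Set (ArcSpace.arcSpace s) :=
    ArcSpace.chart s U '' HasseSchmidt.arcImage h q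
  have hWc (q) (hq : q ∈ I) : IsClosed (W q) := by
    refine hι.isClosed_image (F := ArcSpace.arcProj s ⁻¹' {P}) ?_
      (hPc.preimage (ArcSpace.arcProj s).continuous) ?_ ?_
    · rw [HasseSchmidt.arcImage_eq_arcContact_inter h hφ hinj hfin hbir hp0 hq]
      refine (HasseSchmidt.isClosed_arcContact q).inter ?_
      have hpm := p.isPrime.isMaximal hp0
      exact ((PrimeSpectrum.isClosed_singleton_iff_isMaximal p).mpr hpm).preimage
        (PrimeSpectrum.continuous_comap _)
    · rw [hF]
      exact Set.image_subset_range _ _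
    · rw [hF, ← Set.mem_singleton_iff.mp hq]
      exact Set.image_mono (HasseSchmidt.arcImage_subset_fiber h q)
  have hWinj (q) (hq : q ∈ I) (q') (hq' : q' ∈ I) (hle : W q ⊆ W q') : q = q' :=
    HasseSchmidt.eq_of_arcImage_subset h hφ hinj hfin hbir hp0 hq hq'
      ((Set.image_subset_image_iff hι.injective).mp hle)
  have hcomp := image_irreducibleComponents_eq_image (F := ArcSpace.arcProj s ⁻¹' {P}) (W := W) hI
    hWc (fun q hq ↦ (HasseSchmidt.isIrreducible_arcImage h hφ hinj hfin hp0 hq).image _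
      hι.continuous.continuousOn) ?_ hWinj
  · refine ⟨hfI ▸ hI.image _, ?_, fun Q hQ ↦ ?_⟩
    · have hfI' : (ArcSpace.normalizationMap X ⁻¹' {P}).encard = I.encard :=
        (congrArg Set.encard hfI).trans (V.2.fromSpec.isOpenEmbedding.injective.encard_image I)
      have hWi : Set.InjOn W I := fun q hq q' hq' e ↦ hWinj q hq q' hq' e.subset
      have hvi : Function.Injective fun C : Set (ArcSpace.arcProj s ⁻¹' {P}) ↦ Subtype.val '' C :=
        Set.image_injective.mpr Subtype.val_injective
      rw [hfI', ← hWi.encard_image, ← hcomp, hvi.encard_image]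
    · obtain ⟨q, hq, rfl⟩ := hfI.subset hQ
      have e : ArcSpace.arcMap s f '' (ArcSpace.arcProj (f ≫ s) ⁻¹' {V.2.fromSpec q}) = W q :=
        ArcSpace.arcMap_image_eq_chart_image s f U q
      rw [e, hcomp]
      exact ⟨hWc q hq, q, hq, rfl⟩
  · refine Eq.trans ?_ hF.symm
    refine Eq.trans ?_ (congrArg (ArcSpace.chart s U '' ·)
      (HasseSchmidt.iUnion_arcImage h hφ hinj hfin hbir hp0))
    exact (Set.image_iUnion₂ _ _).symm
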